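/- Let $(\mathbf X,\mathcal B)$ be a measurable space. For a Markov transition probability $\pi$ on $\mathbf X$ put $$\delta(\pi)=\sup_{x_1,x_2\in\mathbf X,\ A\in\mathcal B}|\pi(x_1,A)-\pi(x_2,A)|,\qquad \alpha(\pi)=1-\delta(\pi).$$ For each $n\ge 1$ let $X^{(n)}_1,\dots,X^{(n)}_n$ be a non-homogeneous Markov chain on $\mathbf X$ with an arbitrary initial distribution and with transition probabilities $\pi^{(n)}_{i,i+1}$, $1\le i\le n-1$, that is, $$P\big[X^{(n)}_{i+1}\in A\mid X^{(n)}_1,\dots,X^{(n)}_i\big]=\pi^{(n)}_{i,i+1}\big(X^{(n)}_i,A\big)\quad\text{a.s.}$$ for all $1\le i\le n-1$ and $A\in\mathcal B$. For $n\ge 2$ let $\alpha_n=\min_{1\le i\le n-1}\alpha(\pi^{(n)}_{i,i+1})$. For $n\ge1$ let $f^{(n)}_1,\dots,f^{(n)}_n$ be measurable real-valued functions on $\mathbf X$, and let $S_n=\sum_{i=1}^n f^{(n)}_i(X^{(n)}_i)$. Write $E$ and $V$ for expectation and variance. Suppose that there are constants $C<\infty$ and $c>0$ such that $$\sup_{x\in\mathbf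 X}|f^{(n)}_i(x)|\le C\quad\text{and}\quad V\big(f^{(n)}_i(X^{(n)}_i)\big)\ge c\qquad\text{for all } 1\le i\le n \text{ and } n\ge1 .$$ If $$\lim_{n\to\infty} n^{1/3}\alpha_n=\infty ,$$ then $$\frac{S_n-E[S_n]}{\sqrt{V(S_n)}}\ \Rightarrow\ N(0,1)\qquad (n\to\infty).$$ -/

import Mathlib

open MeasureTheory ProbabilityTheory Filter

open scoped Topology

namespace DobrushinCLT

/-- The contraction coefficient `δ(π) = sup_{x₁, x₂, A} |π(x₁, A) - π(x₂, A)|` of a transition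
probability, the supremum being over points `x₁, x₂` and measurable sets `A`. -/
noncomputable def contractionCoeff {E : Type*} [MeasurableSpace E] (π : Kernel E E) : ℝ :=
  sSup {r : ℝ | ∃ (x₁ x₂ : E) (A : Set E), MeasurableSet A ∧
    r = |(π x₁).real A - (π x₂).real A|}

/-- The coefficient `α(π) = 1 - δ(π)`. -/
noncomputable def alphaCoeff {E : Type*} [MeasurableSpace E] (π : Kernel E E) : ℝ :=
  1 - contractionCoeff π

/-- `min_{1 ≤ i ≤ n - 1} α(π_{i,i+1})`, where `π i` stands for `π_{i,i+1}`. (For `n ≤ 1` the minimum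
is over the empty set, and the value is `0`.) -/
noncomputable def minAlpha {E : Type*} [MeasurableSpace E] (n : ℕ) (π : ℕ → Kernel E E) : ℝ :=
  sInf ((fun i => alphaCoeff (π i)) '' {i : ℕ | 1 ≤ i ∧ i < n})

/-- The sigma-algebra `σ(X₁, …, X_i)`. -/
abbrev history {Ω E : Type*} [MeasurableSpace E] (X : ℕ → Ω → E) (i : ℕ) : MeasurableSpace Ω :=
  ⨆ j ∈ Finset.Icc 1 i, MeasurableSpace.comap (X j) inferInstance

/-- `X₁, …, X_n` is, under `P`, a non-homogeneous Markov chain of length `n` with initial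
distribution `μ` and transition probabilities `π_{i,i+1} = π i`, `1 ≤ i ≤ n - 1`:
`P[X_{i+1} ∈ A | X₁, …, X_i] = π_{i,i+1}(X_i, A)` almost surely. Only the values `X i` with
`1 ≤ i ≤ n` and `π i` with `1 ≤ i ≤ n - 1` matter. -/
structure IsMarkovChain {Ω E : Type*} [MeasurableSpace Ω] [MeasurableSpace E] (n : ℕ)
    (μ : Measure E) (π : ℕ → Kernel E E) (P : Measure Ω) (X : ℕ → Ω → E) : Prop where
  measurable : ∀ i, 1 ≤ i → i ≤ n → Measurable (X i)
  initial : P.map (X 1) = μ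
  markov : ∀ i, 1 ≤ i → i < n → ∀ A : Set E, MeasurableSet A →
    P⟦X (i + 1) ⁻¹' A | history X i⟧ =ᵐ[P] fun ω => (π i (X i ω)).real A

/-- The sum `S_n = ∑_{i=1}^n f_i(X_i)`. -/
def chainSum {Ω E : Type*} (n : ℕ) (f : ℕ → E → ℝ) (X : ℕ → Ω → E) (ω : Ω) : ℝ :=
  ∑ i ∈ Finset.Icc 1 n, f i (X i ω)

end DobrushinCLT

namespace DobrushinCLT

/-! The centred sum is replaced by a martingale. Let `h k` be the conditional expectation of the
centred terms from time `k` on, as a function of the state. With a deterministic state at time `0`,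
the innovations `ξ k` of `h` add up to the centred sum. A transition with coefficient at least `α`
shrinks oscillations by the factor `1 - α`, so geometric summation bounds `h` and `ξ` by a multiple
of `C / α` (`abs_backward_sub_le`).

The variance is at least `α n c / 12`: any two transition laws share a part of mass at least `α`, so
their means can differ only at the expense of conditional variance (`sq_integral_sub_le`,
`mul_integral_sq_le`).

The sum of the `ξ k ^ 2` concentrates because `U k`, the conditional mean of the squares still to
come, oscillates by at most a multiple of `C ^ 2 / α ^ 2`. Adding up conditional variances of size
`C ^ 2 / α ^ 2` would cost another factor `1 / α`. The identity `h ^ 2 - (avg h) ^ 2 = 2 f h - f ^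
2` avoids this: up to one bounded correction, `U k` is the backward sum of functions of size `C ^ 2
/ α` only.

The martingale limit theorem comes from `exp (i x) ≈ (1 + i x) exp (-x ^ 2 / 2)`: the product of the
factors `1 + i x`, stopped when the squares become too large, has mean one. The resulting error is
governed by `C / (α √V)`, whose square is at most a constant times `1 / (n α ^ 3)`; hence the
exponent `1/3`. -/

/-- A real function that is measurable for the sigma-algebra `m` and bounded. -/
def BddMeas {α : Type*} (m : MeasurableSpace α) (g : α → ℝ) : Prop :=
  Measurable[m] g ∧ ∃ B : ℝ, ∀ x, |g x| ≤ B

/-! ### Calculus of bounded measurable functions. -/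

namespace BddMeas

variable {α β : Type*} {m m' : MeasurableSpace α} {g h : α → ℝ}

lemma const (r : ℝ) : BddMeas m (fun _ => r) := ⟨measurable_const, |r|, fun _ => le_rfl⟩

lemma add (hg : BddMeas m g) (hh : BddMeas m h) : BddMeas m (fun x => g x + h x) := by
  obtain ⟨hg, A, hA⟩ := hg
  obtain ⟨hh, B, hB⟩ := hh
  exact ⟨hg.add hh, A + B, fun x => (abs_add_le _ _).trans (add_le_add (hA x) (hB x))⟩

lemma mul (hg : BddMeas m g) (hh : BddMeas m h) : BddMeas m (fun x => g x * h x) := by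
  obtain ⟨hg, A, hA⟩ := hg
  obtain ⟨hh, B, hB⟩ := hh
  refine ⟨hg.mul hh, A * B, fun x => ?_⟩
  rw [abs_mul]
  exact mul_le_mul (hA x) (hB x) (abs_nonneg _) ((abs_nonneg _).trans (hA x))

lemma neg (hg : BddMeas m g) : BddMeas m (fun x => -g x) := by
  obtain ⟨hg, A, hA⟩ := hg
  exact ⟨hg.neg, A, fun x => (abs_neg (g x)).le.trans (hA x)⟩

lemma sub (hg : BddMeas m g) (hh : BddMeas m h) : BddMeas m (fun x => g x - h x) := by
  simpa only [sub_eq_add_neg] using hg.add hh.neg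

lemma pow (hg : BddMeas m g) (k : ℕ) : BddMeas m (fun x => g x ^ k) := by
  obtain ⟨hg, A, hA⟩ := hg
  refine ⟨hg.pow_const k, A ^ k, fun x => ?_⟩
  rw [abs_pow]
  exact pow_le_pow_left₀ (abs_nonneg _) (hA x) k

lemma sum {ι : Type*} (s : Finset ι) {F : ι → α → ℝ} (hF : ∀ i ∈ s, BddMeas m (F i)) :
    BddMeas m (fun x => ∑ i ∈ s, F i x) := by
  classical
  induction s using Finset.induction_on with
  | empty => simpa using const 0
  | insert a s ha ih =>
    simp only [Finset.sum_insert ha]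
    exact (hF a (Finset.mem_insert_self a s)).add
      (ih fun i hi => hF i (Finset.mem_insert_of_mem hi))

lemma mono (hg : BddMeas m g) (hm : m ≤ m') : BddMeas m' g := ⟨hg.1.mono hm le_rfl, hg.2⟩

lemma comp {mβ : MeasurableSpace β} {φ : β → ℝ} (hφ : BddMeas mβ φ) {Y : α → β}
    (hY : Measurable[m] Y) : BddMeas m (fun x => φ (Y x)) := by
  obtain ⟨h, B, hB⟩ := hφ
  exact ⟨h.comp hY, B, fun x => hB _⟩

lemma integrable {α : Type*} {m : MeasurableSpace α} {g : α → ℝ} (hg : BddMeas m g)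
    (μ : Measure α) [IsFiniteMeasure μ] : Integrable g μ := by
  obtain ⟨h, B, hB⟩ := hg
  exact Integrable.of_bound h.aestronglyMeasurable B (ae_of_all _ hB)

lemma integral_add {α : Type*} {m : MeasurableSpace α} {g h : α → ℝ} (hg : BddMeas m g)
    (hh : BddMeas m h) (μ : Measure α) [IsFiniteMeasure μ] :
    ∫ x, (g x + h x) ∂μ = ∫ x, g x ∂μ + ∫ x, h x ∂μ :=
  MeasureTheory.integral_add (hg.integrable μ) (hh.integrable μ)

lemma integral_sub {α : Type*} {m : MeasurableSpace α} {g h : α → ℝ} (hg : BddMeas m g)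
    (hh : BddMeas m h) (μ : Measure α) [IsFiniteMeasure μ] :
    ∫ x, (g x - h x) ∂μ = ∫ x, g x ∂μ - ∫ x, h x ∂μ :=
  MeasureTheory.integral_sub (hg.integrable μ) (hh.integrable μ)

end BddMeas

/-! ### Comparison of two probability measures close in total variation. -/

section TwoMeasures

variable {E : Type*} [mE : MeasurableSpace E] {μ ν : Measure E} [IsProbabilityMeasure μ]
  [IsProbabilityMeasure ν] {d : ℝ} {g : E → ℝ}

/-- Layer-cake formula: after subtraction of its infimum `g` takes values in `[0, r]`, and each
level set contributes a difference of at most `d`. -/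
lemma integral_sub_integral_le_mul (hd : ∀ A, MeasurableSet A → |μ.real A - ν.real A| ≤ d)
    (hg : BddMeas mE g) {r : ℝ} (hr : ∀ x y, |g x - g y| ≤ r) :
    |∫ x, g x ∂μ - ∫ x, g x ∂ν| ≤ d * r := by
  obtain ⟨B, hB⟩ := hg.2
  have : Nonempty E := nonempty_of_isProbabilityMeasure μ
  have hr0 : 0 ≤ r := (abs_nonneg _).trans (hr (Classical.arbitrary E) (Classical.arbitrary E))
  have hbdd : BddBelow (Set.range g) := ⟨-B, by
    rintro _ ⟨x, rfl⟩; exact (abs_le.1 (hB x)).1⟩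
  set a := ⨅ x, g x with ha
  have h0 : ∀ x, 0 ≤ g x - a := fun x => sub_nonneg.2 (ciInf_le hbdd x)
  have h1 : ∀ x, g x - a ≤ r := fun x => by
    have : g x - r ≤ a := le_ciInf fun y => by have := (abs_le.1 (hr x y)).2; linarith
    linarith
  have hG : BddMeas mE (fun x => g x - a) := hg.sub (.const a)
  have key : ∀ (ρ : Measure E) [IsProbabilityMeasure ρ],
      ∫ x, g x ∂ρ = a + ∫ t in (0:ℝ)..r, ρ.real {x | t ≤ g x - a} := by
    intro ρ _
    have e := (hG.integrable ρ).integral_eq_integral_Ioc_meas_le (M := r) (ae_of_all _ h0)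
      (ae_of_all _ h1)
    rw [integral_sub (hg.integrable ρ) (integrable_const a)] at e
    rw [intervalIntegral.integral_of_le hr0, ← e]
    simp
  have hint : ∀ (ρ : Measure E) [IsProbabilityMeasure ρ],
      IntervalIntegrable (fun t => ρ.real {x | t ≤ g x - a}) volume 0 r := by
    intro ρ _
    apply AntitoneOn.intervalIntegrable
    intro s _ t _ hst
    exact measureReal_mono (fun x (hx : t ≤ g x - a) => hst.trans hx)
  rw [key μ, key ν, add_sub_add_left_eq_sub, ← intervalIntegral.integral_sub (hint μ) (hint ν),
    ← Real.norm_eq_abs]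
  refine (intervalIntegral.norm_integral_le_of_norm_le_const (C := d) fun t _ => ?_).trans ?_
  · exact hd _ (hG.1 measurableSet_Ici)
  · rw [sub_zero, abs_of_nonneg hr0]

/-- The common part of `μ` and `ν` has mass at least `1 - d`. On it `g` would have to be near both
means at once, so a gap between the means forces variance. -/
lemma sq_integral_sub_le (hd : ∀ A, MeasurableSet A → |μ.real A - ν.real A| ≤ d)
    (hg : BddMeas mE g) :
    (1 - d) * (∫ x, g x ∂μ - ∫ x, g x ∂ν) ^ 2 ≤
      2 * (∫ x, g x ^ 2 ∂μ - (∫ x, g x ∂μ) ^ 2) + 2 * (∫ x, g x ^ 2 ∂ν - (∫ x, g x ∂ν) ^ 2) := by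
  obtain ⟨s, hs, hνμ, hμν⟩ := hahn_decomposition μ ν
  set a := ∫ x, g x ∂μ with ha
  set b := ∫ x, g x ∂ν with hb
  have hvar : ∀ (ρ : Measure E) [IsProbabilityMeasure ρ],
      ∫ x, g x ^ 2 ∂ρ - (∫ x, g x ∂ρ) ^ 2 = ∫ x, (g x - ∫ y, g y ∂ρ) ^ 2 ∂ρ := by
    intro ρ _
    have e : ∀ x, (g x - ∫ y, g y ∂ρ) ^ 2 =
        g x ^ 2 - 2 * (∫ y, g y ∂ρ) * g x + (∫ y, g y ∂ρ) ^ 2 := fun x => by ring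
    simp only [e]
    have i1 : Integrable (fun x => g x ^ 2 - 2 * (∫ y, g y ∂ρ) * g x) ρ :=
      ((hg.pow 2).integrable ρ).sub ((hg.integrable ρ).const_mul _)
    rw [integral_add i1 (integrable_const _), integral_sub ((hg.pow 2).integrable ρ) ((hg.integrable ρ).const_mul _),
      integral_const_mul]
    simp
    ring
  rw [hvar μ, hvar ν, ← ha, ← hb]
  have hA : BddMeas mE (fun x => (g x - a) ^ 2) := (hg.sub (.const a)).pow 2
  have hB : BddMeas mE (fun x => (g x - b) ^ 2) := (hg.sub (.const b)).pow 2
  have le1 : ν.restrict s ≤ μ.restrict s := by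
    refine Measure.le_iff.2 fun t ht => ?_
    rw [Measure.restrict_apply ht, Measure.restrict_apply ht]
    exact hνμ _ (ht.inter hs) Set.inter_subset_right
  have le2 : μ.restrict sᶜ ≤ ν.restrict sᶜ := by
    refine Measure.le_iff.2 fun t ht => ?_
    rw [Measure.restrict_apply ht, Measure.restrict_apply ht]
    exact hμν _ (ht.inter hs.compl) Set.inter_subset_right
  have step : ∀ (ρ : Measure E) [IsProbabilityMeasure ρ] (t : Set E),
      ρ.real t * (a - b) ^ 2 ≤
        2 * ∫ x in t, (g x - a) ^ 2 ∂ρ + 2 * ∫ x in t, (g x - b) ^ 2 ∂ρ := by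
    intro ρ _ t
    have : ∫ x in t, (a - b) ^ 2 ∂ρ ≤ ∫ x in t, (2 * (g x - a) ^ 2 + 2 * (g x - b) ^ 2) ∂ρ := by
      refine integral_mono (integrable_const _)
        (((hA.integrable _).const_mul 2).add ((hB.integrable _).const_mul 2)) fun x => ?_
      show (a - b) ^ 2 ≤ 2 * (g x - a) ^ 2 + 2 * (g x - b) ^ 2
      nlinarith [sq_nonneg ((g x - a) + (g x - b))]
    rw [integral_add ((hA.integrable _).const_mul 2) ((hB.integrable _).const_mul 2),
      integral_const_mul, integral_const_mul] at this
    simpa using this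
  -- The common part is `ν` on `s` and `μ` on `sᶜ`; its mass is `1 - (μ s - ν s) ≥ 1 - d`.
  have s1 := step ν s
  have s2 := step μ sᶜ
  have m1 : ∫ x in s, (g x - a) ^ 2 ∂ν ≤ ∫ x in s, (g x - a) ^ 2 ∂μ :=
    integral_mono_measure le1 (ae_of_all _ fun x => sq_nonneg _) (hA.integrable _)
  have m2 : ∫ x in sᶜ, (g x - b) ^ 2 ∂μ ≤ ∫ x in sᶜ, (g x - b) ^ 2 ∂ν :=
    integral_mono_measure le2 (ae_of_all _ fun x => sq_nonneg _) (hB.integrable _)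
  have c1 := integral_add_compl hs (hA.integrable μ)
  have c2 := integral_add_compl hs (hB.integrable ν)
  have hc : μ.real sᶜ = 1 - μ.real s := probReal_compl_eq_one_sub hs
  have hds := (abs_le.1 (hd s hs)).2
  have := mul_le_mul_of_nonneg_right hds (sq_nonneg (a - b))
  rw [hc] at s2
  nlinarith

end TwoMeasures

/-! ### Averaging operators and the contraction coefficient. -/

section Average

variable {E : Type*} [mE : MeasurableSpace E]

/-- The function `x ↦ ∫ g(y) κ(x, dy)`. -/
noncomputable def avg (κ : Kernel E E) (g : E → ℝ) (x : E) : ℝ := ∫ y, g y ∂κ x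

lemma BddMeas.avg {g : E → ℝ} (hg : BddMeas mE g) (κ : Kernel E E) [IsMarkovKernel κ] :
    BddMeas mE (avg κ g) := by
  obtain ⟨h, B, hB⟩ := hg
  refine ⟨(h.stronglyMeasurable.integral_kernel (κ := κ)).measurable, B, fun x => ?_⟩
  have := norm_integral_le_of_norm_le_const (μ := κ x) (f := g) (C := B) (ae_of_all _ hB)
  simpa [DobrushinCLT.avg] using this

lemma bddAbove_contraction (κ : Kernel E E) [IsMarkovKernel κ] :
    BddAbove {r : ℝ | ∃ (x₁ x₂ : E) (A : Set E), MeasurableSet A ∧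
      r = |(κ x₁).real A - (κ x₂).real A|} := by
  refine ⟨1, ?_⟩
  rintro _ ⟨x, y, A, _, rfl⟩
  rw [abs_le]
  constructor <;> linarith [measureReal_nonneg (μ := κ x) (s := A),
    measureReal_nonneg (μ := κ y) (s := A), measureReal_le_one (μ := κ x) (s := A),
    measureReal_le_one (μ := κ y) (s := A)]

lemma abs_sub_le_of_le_alphaCoeff {κ : Kernel E E} [IsMarkovKernel κ] {α : ℝ}
    (hα : α ≤ alphaCoeff κ) (x y : E) (A : Set E) (hA : MeasurableSet A) :
    |(κ x).real A - (κ y).real A| ≤ 1 - α := by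
  have : |(κ x).real A - (κ y).real A| ≤ contractionCoeff κ :=
    le_csSup (bddAbove_contraction κ) ⟨x, y, A, hA, rfl⟩
  unfold alphaCoeff at hα
  linarith

lemma alphaCoeff_le_one (κ : Kernel E E) : alphaCoeff κ ≤ 1 := by
  have : 0 ≤ contractionCoeff κ := Real.sSup_nonneg (by
    rintro _ ⟨x, y, A, _, rfl⟩; exact abs_nonneg _)
  unfold alphaCoeff
  linarith

lemma alphaCoeff_const (μ : Measure E) : 1 ≤ alphaCoeff (Kernel.const E μ) := by
  have : contractionCoeff (Kernel.const E μ) ≤ 0 := Real.sSup_nonpos (by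
    rintro _ ⟨x, y, A, _, rfl⟩; simp)
  unfold alphaCoeff
  linarith

end Average

/-! ### Deterministic estimates for the characteristic function of a sum. -/

section Deterministic

lemma norm_prod_sub_prod_le (a b : ℕ → ℂ) (ha : ∀ k, ‖a k‖ ≤ 1) (hb : ∀ k, ‖b k‖ ≤ 1) (n : ℕ) :
    ‖∏ k ∈ Finset.range n, a k - ∏ k ∈ Finset.range n, b k‖ ≤
      ∑ k ∈ Finset.range n, ‖a k - b k‖ := by
  induction n with
  | zero => simp
  | succ n ih =>
    rw [Finset.prod_range_succ, Finset.prod_range_succ, Finset.sum_range_succ]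
    have e : (∏ k ∈ Finset.range n, a k) * a n - (∏ k ∈ Finset.range n, b k) * b n =
        (∏ k ∈ Finset.range n, a k - ∏ k ∈ Finset.range n, b k) * a n +
          (∏ k ∈ Finset.range n, b k) * (a n - b n) := by ring
    have hB : ‖∏ k ∈ Finset.range n, b k‖ ≤ 1 := by
      rw [norm_prod]
      exact Finset.prod_le_one (fun _ _ => norm_nonneg _) fun k _ => hb k
    rw [e]
    refine (norm_add_le _ _).trans (add_le_add ?_ ?_)
    · rw [norm_mul]
      exact (mul_le_of_le_one_right (norm_nonneg _) (ha n)).trans ih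
    · rw [norm_mul]
      exact mul_le_of_le_one_left (norm_nonneg _) hB

lemma norm_one_add_mul_I_le (x : ℝ) : ‖(1 + x * Complex.I : ℂ)‖ ≤ Real.exp (x ^ 2 / 2) := by
  have h : ‖(1 + x * Complex.I : ℂ)‖ ^ 2 = 1 + x ^ 2 := by
    rw [Complex.sq_norm, Complex.normSq_apply]; simp; ring
  refine le_of_sq_le_sq ?_ (Real.exp_pos _).le
  rw [h, ← Real.exp_nat_mul]
  have := Real.add_one_le_exp (x ^ 2)
  calc 1 + x ^ 2 ≤ Real.exp (x ^ 2) := by linarith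
    _ = _ := by congr 1; push_cast; ring

/-- Both terms expand as `1 + i x - x ^ 2 / 2` up to third order. -/
lemma norm_cexp_sub_le {x : ℝ} (hx : |x| ≤ 1) :
    ‖Complex.exp (x * Complex.I) - (1 + x * Complex.I) * Real.exp (-(x ^ 2 / 2))‖ ≤
      2 * |x| ^ 3 := by
  have hn : ‖(x * Complex.I : ℂ)‖ = |x| := by simp
  have h1 := Complex.exp_bound (x := x * Complex.I) (by rw [hn]; exact hx) (n := 3) (by norm_num)
  rw [hn] at h1
  have hx2 : |x| ^ 2 ≤ 1 := pow_le_one₀ (abs_nonneg x) hx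
  have h2 := Real.norm_exp_sub_one_sub_id_le (x := -(x ^ 2 / 2)) (by
    rw [Real.norm_eq_abs, abs_neg, abs_of_nonneg (by positivity), ← sq_abs]; linarith)
  set r : ℝ := Real.exp (-(x ^ 2 / 2)) - 1 - -(x ^ 2 / 2) with hr
  have hr' : Real.exp (-(x ^ 2 / 2)) = 1 - x ^ 2 / 2 + r := by rw [hr]; ring
  have h3 : |r| ≤ |x| ^ 4 / 4 := by
    refine h2.trans (le_of_eq ?_)
    rw [Real.norm_eq_abs, abs_neg, abs_of_nonneg (by positivity), ← sq_abs x]; ring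
  have e : Complex.exp (x * Complex.I) - (1 + x * Complex.I) * Real.exp (-(x ^ 2 / 2)) =
      (Complex.exp (x * Complex.I) - ∑ m ∈ Finset.range 3, (x * Complex.I : ℂ) ^ m / m.factorial) +
        (x ^ 3 / 2 : ℝ) * Complex.I - (1 + x * Complex.I) * (r : ℝ) := by
    rw [hr']
    simp only [Finset.sum_range_succ, Finset.sum_range_zero, Nat.factorial]
    push_cast
    have := Complex.I_sq
    linear_combination ((x : ℂ) ^ 2 / 2) * this
  rw [e]
  have n1 : ‖((x ^ 3 / 2 : ℝ) * Complex.I : ℂ)‖ = |x| ^ 3 / 2 := by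
    rw [norm_mul, Complex.norm_I, mul_one, Complex.norm_real, Real.norm_eq_abs, abs_div, abs_pow]
    norm_num
  have n2 : ‖((1 + x * Complex.I) * (r : ℝ) : ℂ)‖ ≤ 2 * (|x| ^ 4 / 4) := by
    rw [norm_mul, Complex.norm_real]
    refine mul_le_mul ?_ h3 (norm_nonneg _) (by norm_num)
    refine (norm_add_le _ _).trans ?_
    rw [hn, norm_one]; linarith
  have h4 : |x| ^ 4 ≤ |x| ^ 3 := pow_le_pow_of_le_one (abs_nonneg x) hx (by norm_num)
  have h5 : 0 ≤ |x| ^ 3 := by positivity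
  have h6 : ((Nat.succ 3 : ℕ) : ℝ) * (((3 : ℕ).factorial : ℝ) * ((3 : ℕ) : ℝ))⁻¹ ≤ 1 := by
    norm_num [Nat.factorial]
  have h7 : |x| ^ 3 * (((Nat.succ 3 : ℕ) : ℝ) * (((3 : ℕ).factorial : ℝ) * ((3 : ℕ) : ℝ))⁻¹) ≤
      2 / 9 * |x| ^ 3 := by
    norm_num [Nat.factorial]; linarith
  refine (norm_sub_le _ _).trans ?_
  refine (add_le_add_left ((norm_add_le _ _).trans (add_le_add_left h1 _)) _).trans ?_
  rw [n1]
  linarith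

/-- The sequence `x`, stopped once the sum of its squares has exceeded `L`. -/
noncomputable def stopped (L : ℝ) (x : ℕ → ℝ) (k : ℕ) : ℝ :=
  if ∑ j ∈ Finset.range k, x j ^ 2 ≤ L then x k else 0

lemma stopped_eq {L : ℝ} {x : ℕ → ℝ} {n : ℕ} (h : ∑ j ∈ Finset.range n, x j ^ 2 ≤ L) {k : ℕ}
    (hk : k ≤ n) : stopped L x k = x k := by
  refine if_pos (le_trans ?_ h)
  exact Finset.sum_le_sum_of_subset_of_nonneg (Finset.range_mono hk) fun _ _ _ => sq_nonneg _

/-- Only the term that crosses the level `L` can overshoot, and it adds at most `ρ ^ 2`. -/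
lemma sum_stopped_sq_le {L ρ : ℝ} (hL : 0 ≤ L) {x : ℕ → ℝ} (hx : ∀ k, |x k| ≤ ρ) (n : ℕ) :
    ∑ k ∈ Finset.range n, stopped L x k ^ 2 ≤ L + ρ ^ 2 := by
  induction n with
  | zero => simp only [Finset.range_zero, Finset.sum_empty]; positivity
  | succ n ih =>
    rw [Finset.sum_range_succ]
    by_cases h : ∑ j ∈ Finset.range n, x j ^ 2 ≤ L
    · rw [Finset.sum_congr rfl fun k hk => by
        rw [stopped_eq h (Finset.mem_range.1 hk).le], stopped_eq h le_rfl]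
      exact add_le_add h (sq_le_sq.2 ((hx n).trans (le_abs_self _)))
    · rw [stopped, if_neg h]
      simpa using ih

lemma norm_prod_one_add_le (y : ℕ → ℝ) (n : ℕ) :
    ‖∏ k ∈ Finset.range n, (1 + y k * Complex.I : ℂ)‖ ≤
      Real.exp ((∑ k ∈ Finset.range n, y k ^ 2) / 2) := by
  rw [norm_prod, Finset.sum_div, Real.exp_sum]
  exact Finset.prod_le_prod (fun _ _ => norm_nonneg _) fun k _ => norm_one_add_mul_I_le _

lemma norm_cexp_sum_sub_le {τ ρ : ℝ} (hτ : 0 ≤ τ) (hρ : ρ ≤ 1) {x : ℕ → ℝ}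
    (hx : ∀ k, |x k| ≤ ρ) (n : ℕ) :
    ‖Complex.exp ((∑ k ∈ Finset.range n, x k : ℝ) * Complex.I) -
        (∏ k ∈ Finset.range n, (1 + stopped (τ + 1) x k * Complex.I : ℂ)) *
          Real.exp (-(τ / 2))‖ ≤
      (2 * (τ + 1) + 1 + Real.exp (τ + 2)) *
        (ρ + |∑ k ∈ Finset.range n, x k ^ 2 - τ|) := by
  have hρ0 : 0 ≤ ρ := (abs_nonneg _).trans (hx 0)
  have hρ2 : ρ ^ 2 ≤ 1 := pow_le_one₀ hρ0 hρ
  set Q := ∑ k ∈ Finset.range n, x k ^ 2 with hQ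
  set T := ∏ k ∈ Finset.range n, (1 + stopped (τ + 1) x k * Complex.I : ℂ) with hT
  have hTle : ‖T‖ ≤ Real.exp (τ + 2) := by
    refine (norm_prod_one_add_le _ n).trans (Real.exp_le_exp.2 ?_)
    have := sum_stopped_sq_le (L := τ + 1) (by linarith) hx n
    linarith
  have hQ0 : 0 ≤ Q := Finset.sum_nonneg fun _ _ => sq_nonneg _
  have habs := abs_nonneg (Q - τ)
  have hexp := Real.exp_pos (τ + 2)
  -- Here the stopping never acts, and factorwise comparison applies with `Q` in the exponent, then
  -- `Q` is replaced by `τ`.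
  by_cases h : Q ≤ τ + 1
  · have hT' : T = ∏ k ∈ Finset.range n, (1 + x k * Complex.I : ℂ) :=
      Finset.prod_congr rfl fun k hk => by rw [stopped_eq h (Finset.mem_range.1 hk).le]
    have e1 : Complex.exp ((∑ k ∈ Finset.range n, x k : ℝ) * Complex.I) =
        ∏ k ∈ Finset.range n, Complex.exp (x k * Complex.I) := by
      rw [← Complex.exp_sum, ← Finset.sum_mul]; push_cast; rfl
    have e2 : T * Real.exp (-(Q / 2)) =
        ∏ k ∈ Finset.range n, ((1 + x k * Complex.I) * Real.exp (-(x k ^ 2 / 2)) : ℂ) := by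
      rw [Finset.prod_mul_distrib, ← hT', ← Complex.ofReal_prod, ← Real.exp_sum,
        Finset.sum_neg_distrib, ← Finset.sum_div]
    have s1 : ‖Complex.exp ((∑ k ∈ Finset.range n, x k : ℝ) * Complex.I) -
        T * Real.exp (-(Q / 2))‖ ≤ 2 * (τ + 1) * ρ := by
      rw [e1, e2]
      refine (norm_prod_sub_prod_le _ _ (fun k => ?_) (fun k => ?_) n).trans ?_
      · rw [Complex.norm_exp_ofReal_mul_I]
      · rw [norm_mul, Complex.norm_real, Real.norm_eq_abs, abs_of_pos (Real.exp_pos _)]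
        refine (mul_le_mul_of_nonneg_right (norm_one_add_mul_I_le _) (Real.exp_pos _).le).trans ?_
        rw [← Real.exp_add, add_neg_cancel, Real.exp_zero]
      · calc ∑ k ∈ Finset.range n, ‖Complex.exp (x k * Complex.I) -
              (1 + x k * Complex.I) * Real.exp (-(x k ^ 2 / 2))‖
            ≤ ∑ k ∈ Finset.range n, 2 * ρ * x k ^ 2 := by
              refine Finset.sum_le_sum fun k _ => (norm_cexp_sub_le ((hx k).trans hρ)).trans ?_
              have := mul_le_mul_of_nonneg_right (hx k) (sq_nonneg |x k|)
              rw [← sq_abs (x k)]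
              nlinarith
          _ = 2 * ρ * Q := by rw [Finset.mul_sum]
          _ ≤ 2 * (τ + 1) * ρ := by nlinarith
    have s2 : ‖T * Real.exp (-(Q / 2)) - T * Real.exp (-(τ / 2))‖ ≤
        Real.exp (τ + 2) * |Q - τ| := by
      rw [← mul_sub, norm_mul, ← Complex.ofReal_sub, Complex.norm_real, Real.norm_eq_abs]
      refine mul_le_mul hTle ?_ (abs_nonneg _) hexp.le
      have lip : ∀ u v : ℝ, 0 ≤ u → u ≤ v → |Real.exp (-(u / 2)) - Real.exp (-(v / 2))| ≤
          |u - v| := by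
        intro u v hu huv
        have h1 : Real.exp (-(v / 2)) ≤ Real.exp (-(u / 2)) := Real.exp_le_exp.2 (by linarith)
        rw [abs_of_nonneg (by linarith), abs_of_nonpos (by linarith)]
        have h2 : Real.exp (-(v / 2)) = Real.exp (-(u / 2)) * Real.exp (-((v - u) / 2)) := by
          rw [← Real.exp_add]; congr 1; ring
        have h3 := Real.add_one_le_exp (-((v - u) / 2))
        have h4 : Real.exp (-(u / 2)) ≤ 1 := Real.exp_le_one_iff.2 (by linarith)
        have h5 := Real.exp_pos (-(u / 2))
        rw [h2]
        nlinarith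
      rcases le_total Q τ with hq | hq
      · exact lip Q τ hQ0 hq
      · rw [abs_sub_comm, abs_sub_comm Q]; exact lip τ Q hτ hq
    calc _ ≤ _ := norm_sub_le_norm_sub_add_norm_sub _ (T * Real.exp (-(Q / 2))) _
      _ ≤ 2 * (τ + 1) * ρ + Real.exp (τ + 2) * |Q - τ| := add_le_add s1 s2
      _ ≤ _ := by
        have : 0 ≤ (1 + Real.exp (τ + 2)) * ρ := by positivity
        have : 0 ≤ (2 * (τ + 1) + 1) * |Q - τ| := by positivity
        nlinarith
  -- Here the error term is at least one, so crude bounds on both quantities suffice.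
  · have h1 : 1 ≤ |Q - τ| := by rw [abs_of_pos] <;> linarith
    have : Real.exp (-(τ / 2)) ≤ 1 := Real.exp_le_one_iff.2 (by linarith)
    have hle : ‖T * Real.exp (-(τ / 2))‖ ≤ Real.exp (τ + 2) := by
      rw [norm_mul, Complex.norm_real, Real.norm_eq_abs, abs_of_pos (Real.exp_pos _)]
      exact (mul_le_of_le_one_right (norm_nonneg _) this).trans hTle
    refine (norm_sub_le _ _).trans ?_
    rw [Complex.norm_exp_ofReal_mul_I]
    refine (add_le_add_right hle _).trans ?_
    have : 1 + Real.exp (τ + 2) ≤ (2 * (τ + 1) + 1 + Real.exp (τ + 2)) := by linarith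
    exact this.trans (le_mul_of_one_le_right (by positivity) (by linarith))

end Deterministic

/-! ### Bounded martingale differences: limit theorem and sum of squares. -/

section Martingale

variable {Ω : Type*} {mΩ : MeasurableSpace Ω} {P : Measure Ω} [IsProbabilityMeasure P]
  {ℱ : Filtration ℕ mΩ} {ξ : ℕ → Ω → ℝ}

lemma BddMeas.stopped_indicator (hξ : ∀ k, BddMeas (ℱ (k + 1)) (ξ k)) (L : ℝ) (k : ℕ) :
    BddMeas (ℱ k) (fun ω => if ∑ j ∈ Finset.range k, ξ j ω ^ 2 ≤ L then (1 : ℝ) else 0) := by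
  have h : BddMeas (ℱ k) (fun ω => ∑ j ∈ Finset.range k, ξ j ω ^ 2) :=
    .sum _ fun j hj => ((hξ j).mono (ℱ.mono (Finset.mem_range.1 hj))).pow 2
  refine ⟨Measurable.ite (h.1 measurableSet_Iic) measurable_const measurable_const, 1,
    fun ω => ?_⟩
  dsimp only
  split_ifs <;> simp

/-- The decision to stop before step `n` depends only on the past, so each new factor has
conditional mean one. Real and imaginary parts are kept apart because the martingale property is
tested against real functions. -/
lemma exists_prod_stopped_eq (hξ : ∀ k, BddMeas (ℱ (k + 1)) (ξ k))
    (hmart : ∀ k g, BddMeas (ℱ k) g → ∫ ω, g ω * ξ k ω ∂P = 0) (L : ℝ) (n : ℕ) :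
    ∃ A B : Ω → ℝ, BddMeas (ℱ n) A ∧ BddMeas (ℱ n) B ∧ ∫ ω, A ω ∂P = 1 ∧ ∫ ω, B ω ∂P = 0 ∧
      ∀ ω, ∏ k ∈ Finset.range n, (1 + stopped L (fun j => ξ j ω) k * Complex.I : ℂ) =
        A ω + B ω * Complex.I := by
  induction n with
  | zero => exact ⟨fun _ => 1, fun _ => 0, .const 1, .const 0, by simp, by simp, by simp⟩
  | succ n ih =>
    obtain ⟨A, B, hA, hB, iA, iB, hAB⟩ := ih
    set J : Ω → ℝ := fun ω => if ∑ j ∈ Finset.range n, ξ j ω ^ 2 ≤ L then (1 : ℝ) else 0 with hJ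
    have hJm : BddMeas (ℱ n) J := BddMeas.stopped_indicator hξ L n
    have hA' := hA.mono (ℱ.mono n.le_succ)
    have hB' := hB.mono (ℱ.mono n.le_succ)
    have hJ' := hJm.mono (ℱ.mono n.le_succ)
    have eJ : ∀ ω, stopped L (fun j => ξ j ω) n = J ω * ξ n ω := fun ω => by
      simp only [stopped, hJ]; split_ifs <;> simp
    refine ⟨fun ω => A ω - B ω * J ω * ξ n ω, fun ω => B ω + A ω * J ω * ξ n ω,
      hA'.sub ((hB'.mul hJ').mul (hξ n)), hB'.add ((hA'.mul hJ').mul (hξ n)), ?_, ?_, fun ω => ?_⟩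
    · rw [integral_sub ((hA.mono (ℱ.le n)).integrable P)
        ((((hB'.mul hJ').mul (hξ n)).mono (ℱ.le _)).integrable P), hmart n _ (hB.mul hJm), iA,
        sub_zero]
    · rw [integral_add ((hB.mono (ℱ.le n)).integrable P)
        ((((hA'.mul hJ').mul (hξ n)).mono (ℱ.le _)).integrable P), hmart n _ (hA.mul hJm), iB,
        add_zero]
    · rw [Finset.prod_range_succ, hAB, eJ]
      push_cast
      have := Complex.I_sq
      linear_combination ((B ω : ℂ) * J ω * ξ n ω) * this

/-- A quantitative central limit theorem for bounded martingale differences, at the level of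
characteristic functions. -/
lemma norm_integral_cexp_sub_le (hξ : ∀ k, BddMeas (ℱ (k + 1)) (ξ k))
    (hmart : ∀ k g, BddMeas (ℱ k) g → ∫ ω, g ω * ξ k ω ∂P = 0) {τ ρ : ℝ} (hτ : 0 ≤ τ)
    (hρ : ρ ≤ 1) (hle : ∀ k ω, |ξ k ω| ≤ ρ) (n : ℕ) :
    ‖∫ ω, Complex.exp ((∑ k ∈ Finset.range n, ξ k ω : ℝ) * Complex.I) ∂P -
        Real.exp (-(τ / 2))‖ ≤
      (2 * (τ + 1) + 1 + Real.exp (τ + 2)) *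
        (ρ + ∫ ω, |∑ k ∈ Finset.range n, ξ k ω ^ 2 - τ| ∂P) := by
  obtain ⟨A, B, hA, hB, iA, iB, hAB⟩ := exists_prod_stopped_eq hξ hmart (τ + 1) n
  have hA1 : Integrable (fun ω => (A ω : ℂ)) P := ((hA.mono (ℱ.le n)).integrable P).ofReal
  have hB1 : Integrable (fun ω => (B ω : ℂ) * Complex.I) P :=
    ((hB.mono (ℱ.le n)).integrable P).ofReal.mul_const _
  have hS : BddMeas mΩ (fun ω => ∑ k ∈ Finset.range n, ξ k ω) :=
    .sum _ fun k _ => (hξ k).mono (ℱ.le _)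
  have hQ : BddMeas mΩ (fun ω => ∑ k ∈ Finset.range n, ξ k ω ^ 2 - τ) :=
    (BddMeas.sum _ fun k _ => ((hξ k).mono (ℱ.le _)).pow 2).sub (.const _)
  have hE : Integrable (fun ω =>
      Complex.exp ((∑ k ∈ Finset.range n, ξ k ω : ℝ) * Complex.I)) P := by
    refine Integrable.of_bound (C := 1) ?_ (ae_of_all _ fun ω => ?_)
    · have := hS.1
      exact Measurable.aestronglyMeasurable (by fun_prop)
    · rw [Complex.norm_exp_ofReal_mul_I]
  -- As the stopped product has mean one, the Gaussian value is itself an integral, and the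
  -- pointwise estimate can be integrated.
  have iT : ∫ ω, ((A ω : ℂ) + B ω * Complex.I) * (Real.exp (-(τ / 2)) : ℂ) ∂P =
      Real.exp (-(τ / 2)) := by
    rw [integral_mul_const, integral_add hA1 hB1, integral_mul_const, integral_complex_ofReal,
      integral_complex_ofReal, iA, iB]
    simp
  have hT1 : Integrable (fun ω => ((A ω : ℂ) + B ω * Complex.I) * (Real.exp (-(τ / 2)) : ℂ)) P :=
    (hA1.add hB1).mul_const _
  rw [← iT, ← integral_sub hE hT1]
  have hQi : Integrable (fun ω => ρ + |∑ k ∈ Finset.range n, ξ k ω ^ 2 - τ|) P :=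
    (integrable_const ρ).add (hQ.integrable P).abs
  refine (norm_integral_le_of_norm_le
    (hQi.const_mul (2 * (τ + 1) + 1 + Real.exp (τ + 2))) (ae_of_all _ fun ω => ?_)).trans
    (le_of_eq ?_)
  · have := norm_cexp_sum_sub_le hτ hρ (fun k => hle k ω) n
    rw [hAB ω] at this
    exact this
  · rw [integral_const_mul, integral_add (integrable_const _) (hQ.integrable P).abs]
    simp

/-- If the conditional expectations of the remaining sum of squares are within `η` of their
means, the sum of squares is close to its mean in quadratic mean. -/
lemma integral_sq_sum_sq_sub_le {U : ℕ → Ω → ℝ} (hξ : ∀ k, BddMeas (ℱ (k + 1)) (ξ k))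
    (hU : ∀ k, BddMeas (ℱ k) (U k))
    (hcond : ∀ k g, BddMeas (ℱ k) g → ∫ ω, g ω * (ξ k ω ^ 2 + U (k + 1) ω) ∂P =
      ∫ ω, g ω * U k ω ∂P) {B η : ℝ} (hle : ∀ k ω, |ξ k ω| ≤ B)
    (hη : ∀ k ω, |U k ω - ∫ ω', U k ω' ∂P| ≤ η) {n : ℕ} (hn : ∀ ω, U n ω = 0) :
    ∫ ω, (∑ k ∈ Finset.range n, ξ k ω ^ 2 - ∫ ω', U 0 ω' ∂P) ^ 2 ∂P ≤
      (B ^ 2 + 2 * η) * ∫ ω, U 0 ω ∂P := by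
  set c : ℕ → ℝ := fun k => ∫ ω, U k ω ∂P with hc
  set Q : ℕ → Ω → ℝ := fun k ω => ∑ j ∈ Finset.range k, ξ j ω ^ 2 with hQ
  set s : ℕ → ℝ := fun k => ∫ ω, ξ k ω ^ 2 ∂P with hs
  have bξ : ∀ k, BddMeas mΩ (ξ k) := fun k => (hξ k).mono (ℱ.le _)
  have bU : ∀ k, BddMeas mΩ (U k) := fun k => (hU k).mono (ℱ.le _)
  have hQm : ∀ k, BddMeas (ℱ k) (Q k) := fun k =>
    .sum _ fun j hj => ((hξ j).mono (ℱ.mono (Finset.mem_range.1 hj))).pow 2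
  have bQ : ∀ k, BddMeas mΩ (Q k) := fun k => (hQm k).mono (ℱ.le _)
  have hcs : ∀ k, c k = s k + c (k + 1) := fun k => by
    have := hcond k (fun _ => 1) (.const 1)
    simp only [one_mul] at this
    rw [integral_add (((bξ k).pow 2).integrable P) ((bU _).integrable P)] at this
    exact this.symm
  have hsum : ∀ k, ∫ ω, Q k ω ∂P = c 0 - c k := by
    intro k
    induction k with
    | zero => simp [hQ]
    | succ k ih =>
      have : ∀ ω, Q (k + 1) ω = Q k ω + ξ k ω ^ 2 := fun ω => by
        simp only [hQ, Finset.sum_range_succ]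
      simp only [this]
      rw [integral_add ((bQ k).integrable P) (((bξ k).pow 2).integrable P), ih]
      have := hcs k
      simp only [hs] at this
      linarith
  -- The quantity `E[Q k ^ 2 + 2 Q k U k] + c k ^ 2` grows by at most `(B ^ 2 + 2 η) s k` per step.
  -- The term `2 c (k + 1) s k`, left by the mean of `U (k + 1)`, is absorbed by `c k ^ 2 = (s k + c
  -- (k + 1)) ^ 2`.
  have step : ∀ k, (∫ ω, (Q (k + 1) ω ^ 2 + 2 * (Q (k + 1) ω * U (k + 1) ω)) ∂P)
      + c (k + 1) ^ 2 ≤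
      (∫ ω, (Q k ω ^ 2 + 2 * (Q k ω * U k ω)) ∂P) + c k ^ 2 + (B ^ 2 + 2 * η) * s k := by
    intro k
    have e : ∀ ω, Q (k + 1) ω ^ 2 + 2 * (Q (k + 1) ω * U (k + 1) ω) =
        (Q k ω ^ 2 + 2 * (Q k ω * (ξ k ω ^ 2 + U (k + 1) ω))) +
          ξ k ω ^ 2 * (ξ k ω ^ 2 + 2 * U (k + 1) ω) := fun ω => by
      simp only [hQ, Finset.sum_range_succ]; ring
    have b1 : BddMeas mΩ (fun ω => Q k ω * (ξ k ω ^ 2 + U (k + 1) ω)) :=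
      (bQ k).mul (((bξ k).pow 2).add (bU _))
    have b2 : BddMeas mΩ (fun ω => ξ k ω ^ 2 * (ξ k ω ^ 2 + 2 * U (k + 1) ω)) :=
      ((bξ k).pow 2).mul (((bξ k).pow 2).add ((BddMeas.const 2).mul (bU _)))
    have b3 : BddMeas mΩ (fun ω => Q k ω * U k ω) := (bQ k).mul (bU k)
    have b0 : BddMeas mΩ (fun ω => Q k ω ^ 2) := (bQ k).pow 2
    have b1' := (BddMeas.const 2).mul b1
    simp only [e]
    rw [(b0.add b1').integral_add b2, b0.integral_add b1',
      b0.integral_add ((BddMeas.const 2).mul b3), integral_const_mul, integral_const_mul, hcond k _ (hQm k)]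
    have bound : ∫ ω, ξ k ω ^ 2 * (ξ k ω ^ 2 + 2 * U (k + 1) ω) ∂P ≤
        ∫ ω, (B ^ 2 + 2 * (c (k + 1) + η)) * ξ k ω ^ 2 ∂P := by
      refine integral_mono (b2.integrable P) ((((bξ k).pow 2).integrable P).const_mul _)
        fun ω => ?_
      have h1 : ξ k ω ^ 2 ≤ B ^ 2 := sq_le_sq.2 ((hle k ω).trans (le_abs_self _))
      have h2 := (abs_le.1 (hη (k + 1) ω)).2
      show ξ k ω ^ 2 * (ξ k ω ^ 2 + 2 * U (k + 1) ω) ≤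
        (B ^ 2 + 2 * (c (k + 1) + η)) * ξ k ω ^ 2
      have : U (k + 1) ω ≤ c (k + 1) + η := by simp only [hc]; linarith
      nlinarith [sq_nonneg (ξ k ω)]
    rw [integral_const_mul] at bound
    have := hcs k
    simp only [hs] at this ⊢
    rw [this]
    nlinarith [sq_nonneg (∫ ω, ξ k ω ^ 2 ∂P)]
  have total : ∀ k, (∫ ω, (Q k ω ^ 2 + 2 * (Q k ω * U k ω)) ∂P) + c k ^ 2 ≤
      c 0 ^ 2 + (B ^ 2 + 2 * η) * (c 0 - c k) := by
    intro k
    induction k with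
    | zero => simp [hQ]
    | succ k ih =>
      have h := step k
      rw [show s k = c k - c (k + 1) by linarith [hcs k]] at h
      linarith
  have fin := total n
  have cn : c n = 0 := by simp [hc, hn]
  simp only [hn, mul_zero, add_zero, cn] at fin
  have ex : ∀ ω, (Q n ω - c 0) ^ 2 = (Q n ω ^ 2 - 2 * c 0 * Q n ω) + c 0 ^ 2 := fun ω => by ring
  have b0 : BddMeas mΩ (fun ω => Q n ω ^ 2) := (bQ n).pow 2
  have b1 : BddMeas mΩ (fun ω => 2 * c 0 * Q n ω) := (BddMeas.const (2 * c 0)).mul (bQ n)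
  change ∫ ω, (Q n ω - c 0) ^ 2 ∂P ≤ _
  simp only [ex]
  rw [(b0.sub b1).integral_add (.const _), b0.integral_sub b1, integral_const_mul, hsum, cn]
  simp only [integral_const, probReal_univ, one_smul]
  simp only [hc] at fin ⊢
  nlinarith

end Martingale

/-- Converts bounds on oscillation into bounds on the distance from the mean. -/
lemma abs_sub_integral_le {α : Type*} {m : MeasurableSpace α} {μ : Measure α}
    [IsProbabilityMeasure μ] {F : α → ℝ} (hF : BddMeas m F) {a r : ℝ}
    (h : ∀ x, |a - F x| ≤ r) : |a - ∫ x, F x ∂μ| ≤ r := by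
  have e : a - ∫ x, F x ∂μ = ∫ x, (a - F x) ∂μ := by
    rw [(BddMeas.const a).integral_sub hF]; simp
  rw [e]
  have := norm_integral_le_of_norm_le_const (μ := μ) (f := fun x => a - F x) (C := r)
    (ae_of_all _ h)
  simpa using this

section Martingale

variable {Ω : Type*} {mΩ : MeasurableSpace Ω} {P : Measure Ω} [IsProbabilityMeasure P]
  {ℱ : Filtration ℕ mΩ} {ξ : ℕ → Ω → ℝ}

lemma integral_sq_sum_eq (hξ : ∀ k, BddMeas (ℱ (k + 1)) (ξ k))
    (hmart : ∀ k g, BddMeas (ℱ k) g → ∫ ω, g ω * ξ k ω ∂P = 0) (n : ℕ) :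
    ∫ ω, (∑ k ∈ Finset.range n, ξ k ω) ^ 2 ∂P = ∑ k ∈ Finset.range n, ∫ ω, ξ k ω ^ 2 ∂P := by
  induction n with
  | zero => simp
  | succ n ih =>
    have hM : BddMeas (ℱ n) (fun ω => ∑ k ∈ Finset.range n, ξ k ω) :=
      .sum _ fun k hk => (hξ k).mono (ℱ.mono (Finset.mem_range.1 hk))
    have bM := hM.mono (ℱ.le n)
    have bξ := (hξ n).mono (ℱ.le _)
    have e : ∀ ω, (∑ k ∈ Finset.range (n + 1), ξ k ω) ^ 2 =
        ((∑ k ∈ Finset.range n, ξ k ω) ^ 2 + 2 * ((∑ k ∈ Finset.range n, ξ k ω) * ξ n ω)) +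
          ξ n ω ^ 2 := fun ω => by rw [Finset.sum_range_succ]; ring
    have b1 := (BddMeas.const 2).mul (bM.mul bξ)
    simp only [e]
    rw [((bM.pow 2).add b1).integral_add (bξ.pow 2), (bM.pow 2).integral_add b1,
      integral_const_mul, hmart n _ hM, ih, Finset.sum_range_succ]
    simp

lemma integral_eq_sum_of_cond {U : ℕ → Ω → ℝ} (hξ : ∀ k, BddMeas (ℱ (k + 1)) (ξ k))
    (hU : ∀ k, BddMeas (ℱ k) (U k))
    (hcond : ∀ k g, BddMeas (ℱ k) g → ∫ ω, g ω * (ξ k ω ^ 2 + U (k + 1) ω) ∂P =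
      ∫ ω, g ω * U k ω ∂P) (n : ℕ) :
    ∫ ω, U 0 ω ∂P = ∑ k ∈ Finset.range n, ∫ ω, ξ k ω ^ 2 ∂P + ∫ ω, U n ω ∂P := by
  induction n with
  | zero => simp
  | succ n ih =>
    have := hcond n (fun _ => 1) (.const 1)
    simp only [one_mul] at this
    rw [(((hξ n).mono (ℱ.le _)).pow 2).integral_add ((hU (n + 1)).mono (ℱ.le _))] at this
    rw [ih, Finset.sum_range_succ, ← this]
    ring

end Martingale

/-! ### Chains in infinite time, backward equations and innovations. -/

section Chain

variable {E Ω : Type*} [mE : MeasurableSpace E] {mΩ : MeasurableSpace Ω}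

/-- A Markov chain in infinite time, with transition probability `κ k` from time `k` to time
`k + 1`; the Markov property is stated through integrals of bounded functions. -/
structure IsChain (P : Measure Ω) (ℱ : Filtration ℕ mΩ) (Y : ℕ → Ω → E) (κ : ℕ → Kernel E E) :
    Prop where
  measurable : ∀ k, Measurable[ℱ k] (Y k)
  markov : ∀ k (g : Ω → ℝ) (φ : E → ℝ), BddMeas (ℱ k) g → BddMeas mE φ →
    ∫ ω, g ω * φ (Y (k + 1) ω) ∂P = ∫ ω, g ω * avg (κ k) φ (Y k ω) ∂P

/-- The sum of the conditional expectations of `f k, …, f (k + m - 1)` along a chain that is at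
time `k` in a given state. -/
noncomputable def tailMean (κ : ℕ → Kernel E E) (f : ℕ → E → ℝ) : ℕ → ℕ → E → ℝ
  | 0, _ => fun _ => 0
  | m + 1, k => fun x => f k x + avg (κ k) (tailMean κ f m (k + 1)) x

/-- Truncated subtraction `N - k` gives the empty sum from time `N` on, so a single recursion holds
at all times. -/
lemma exists_backward_solution (κ : ℕ → Kernel E E) (f : ℕ → E → ℝ) (N : ℕ)
    (hf : ∀ k, N ≤ k → ∀ x, f k x = 0) :
    ∃ h : ℕ → E → ℝ, (∀ k x, h k x = f k x + avg (κ k) (h (k + 1)) x) ∧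
      ∀ k, N ≤ k → ∀ x, h k x = 0 := by
  have h0 : ∀ k, N ≤ k → ∀ x, tailMean κ f (N - k) k x = 0 := fun k hk x => by
    rw [Nat.sub_eq_zero_of_le hk]; rfl
  refine ⟨fun k => tailMean κ f (N - k) k, fun k x => ?_, h0⟩
  rcases le_or_gt N k with hk | hk
  · have : tailMean κ f (N - (k + 1)) (k + 1) = fun _ => 0 :=
      funext fun x => h0 (k + 1) (by omega) x
    simp only [h0 k hk, hf k hk, this, avg]
    simp
  · obtain ⟨m, hm⟩ : ∃ m, N - k = m + 1 := ⟨N - k - 1, by omega⟩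
    have hm' : N - (k + 1) = m := by omega
    simp only [hm, hm']
    rfl

lemma backward_induction {p : ℕ → Prop} (N : ℕ) (h0 : ∀ k, N ≤ k → p k)
    (h1 : ∀ k, p (k + 1) → p k) (k : ℕ) : p k := by
  rcases le_total N k with h | h
  · exact h0 k h
  · exact Nat.decreasingInduction' (fun j _ _ => h1 j) h (h0 N le_rfl)

variable {κ : ℕ → Kernel E E} {P : Measure Ω} {ℱ : Filtration ℕ mΩ} {Y : ℕ → Ω → E}

namespace IsChain

lemma bddMeas (hY : IsChain P ℱ Y κ) {φ : E → ℝ} (hφ : BddMeas mE φ) (k : ℕ) :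
    BddMeas (ℱ k) (fun ω => φ (Y k ω)) := hφ.comp (hY.measurable k)

lemma bddMeas' (hY : IsChain P ℱ Y κ) {φ : E → ℝ} (hφ : BddMeas mE φ) (k : ℕ) :
    BddMeas mΩ (fun ω => φ (Y k ω)) := (hY.bddMeas hφ k).mono (ℱ.le k)

lemma integral_succ (hY : IsChain P ℱ Y κ) {φ : E → ℝ} (hφ : BddMeas mE φ) (k : ℕ) :
    ∫ ω, φ (Y (k + 1) ω) ∂P = ∫ ω, avg (κ k) φ (Y k ω) ∂P := by
  simpa using hY.markov k (fun _ => 1) φ (.const 1) hφ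

end IsChain

variable [∀ k, IsMarkovKernel (κ k)] {f h : ℕ → E → ℝ} {N : ℕ}

lemma bddMeas_backward (hf : ∀ k, BddMeas mE (f k))
    (hh : ∀ k x, h k x = f k x + avg (κ k) (h (k + 1)) x)
    (hN : ∀ k, N ≤ k → ∀ x, h k x = 0) (k : ℕ) : BddMeas mE (h k) := by
  refine backward_induction (p := fun k => BddMeas mE (h k)) N (fun k hk => ?_)
    (fun k ih => ?_) k
  · rw [funext (hN k hk)]; exact .const 0
  · rw [funext (hh k)]; exact (hf k).add (ih.avg _)

lemma abs_avg_sub_avg_le {κ : Kernel E E} [IsMarkovKernel κ] {α : ℝ} (hα : α ≤ alphaCoeff κ)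
    {g : E → ℝ} (hg : BddMeas mE g) {r : ℝ} (hr : ∀ x y, |g x - g y| ≤ r) (x y : E) :
    |avg κ g x - avg κ g y| ≤ (1 - α) * r :=
  integral_sub_integral_le_mul (abs_sub_le_of_le_alphaCoeff hα x y) hg hr

/-- The bound `r / α` is the fixed point of `s ↦ r + (1 - α) s`, hence is preserved backwards in
time. -/
lemma abs_backward_sub_le {α r : ℝ} (hα0 : 0 < α) (hα : ∀ k, α ≤ alphaCoeff (κ k))
    (hr0 : 0 ≤ r) (hf : ∀ k, BddMeas mE (f k)) (hr : ∀ k x y, |f k x - f k y| ≤ r)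
    (hh : ∀ k x, h k x = f k x + avg (κ k) (h (k + 1)) x)
    (hN : ∀ k, N ≤ k → ∀ x, h k x = 0) (k : ℕ) : ∀ x y, |h k x - h k y| ≤ r / α := by
  refine backward_induction (p := fun k => ∀ x y, |h k x - h k y| ≤ r / α) N
    (fun k hk x y => ?_) (fun k ih x y => ?_) k
  · rw [hN k hk, hN k hk, sub_zero, abs_zero]; positivity
  · have h1 := abs_avg_sub_avg_le (hα k) (bddMeas_backward hf hh hN (k + 1)) ih x y
    have h2 := hr k x y
    rw [hh, hh]
    calc _ = |(f k x - f k y) + (avg (κ k) (h (k + 1)) x - avg (κ k) (h (k + 1)) y)| := by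
          congr 1; ring
      _ ≤ r + (1 - α) * (r / α) := (abs_add_le _ _).trans (add_le_add h2 h1)
      _ = r / α := by field_simp; ring

/-- The martingale difference `φ(Y_{k+1}) - E[φ(Y_{k+1}) | Y_k]`. -/
noncomputable def innov (κ : ℕ → Kernel E E) (Y : ℕ → Ω → E) (φ : ℕ → E → ℝ)
    (k : ℕ) (ω : Ω) : ℝ :=
  φ (k + 1) (Y (k + 1) ω) - avg (κ k) (φ (k + 1)) (Y k ω)

namespace IsChain

lemma bddMeas_innov {φ : ℕ → E → ℝ} (hY : IsChain P ℱ Y κ) (hφ : ∀ k, BddMeas mE (φ k)) (k : ℕ) :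
    BddMeas (ℱ (k + 1)) (innov κ Y φ k) :=
  (hY.bddMeas (hφ _) _).sub ((hY.bddMeas ((hφ _).avg (κ k)) k).mono (ℱ.mono k.le_succ))

end IsChain

variable [IsProbabilityMeasure P] {φ : ℕ → E → ℝ}

namespace IsChain

lemma integral_backward_eq_zero (hY : IsChain P ℱ Y κ) (hf : ∀ k, BddMeas mE (f k))
    (hmean : ∀ k, ∫ ω, f k (Y k ω) ∂P = 0)
    (hh : ∀ k x, h k x = f k x + avg (κ k) (h (k + 1)) x)
    (hN : ∀ k, N ≤ k → ∀ x, h k x = 0) (k : ℕ) : ∫ ω, h k (Y k ω) ∂P = 0 := by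
  refine backward_induction (p := fun k => ∫ ω, h k (Y k ω) ∂P = 0) N (fun k hk => ?_)
    (fun k ih => ?_) k
  · simp [hN k hk]
  · have bh := bddMeas_backward hf hh hN (k + 1)
    simp only [hh k]
    rw [(hY.bddMeas' (hf k) k).integral_add (hY.bddMeas' (bh.avg (κ k)) k), hmean,
      ← hY.integral_succ bh, ih, add_zero]

lemma integral_mul_innov (hY : IsChain P ℱ Y κ) (hφ : ∀ k, BddMeas mE (φ k)) (k : ℕ)
    (g : Ω → ℝ) (hg : BddMeas (ℱ k) g) : ∫ ω, g ω * innov κ Y φ k ω ∂P = 0 := by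
  have bg := hg.mono (ℱ.le k)
  simp only [innov, mul_sub]
  rw [(bg.mul (hY.bddMeas' (hφ _) _)).integral_sub
    (bg.mul (hY.bddMeas' ((hφ _).avg (κ k)) k)), hY.markov k g _ hg (hφ _), sub_self]

/-- Gives the recursion for the conditional mean of the squares still to come. In the cross term,
`g` times the conditional mean of `φ` is again known at time `k`, so the Markov property applies to
it. -/
lemma integral_mul_innov_sq_add (hY : IsChain P ℱ Y κ) (hφ : ∀ k, BddMeas mE (φ k))
    {ψ : E → ℝ} (hψ : BddMeas mE ψ) (k : ℕ) (g : Ω → ℝ) (hg : BddMeas (ℱ k) g) :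
    ∫ ω, g ω * (innov κ Y φ k ω ^ 2 + ψ (Y (k + 1) ω)) ∂P =
      ∫ ω, g ω * (avg (κ k) (fun x => φ (k + 1) x ^ 2 + ψ x) (Y k ω)
        - avg (κ k) (φ (k + 1)) (Y k ω) ^ 2) ∂P := by
  have bg := hg.mono (ℱ.le k)
  have bχ : BddMeas mE (fun x => φ (k + 1) x ^ 2 + ψ x) := ((hφ _).pow 2).add hψ
  have ba := hY.bddMeas ((hφ (k + 1)).avg (κ k)) k
  have ba' := ba.mono (ℱ.le k)
  have bχ1 := hY.bddMeas' bχ (k + 1)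
  have bφ1 := hY.bddMeas' (hφ (k + 1)) (k + 1)
  have e : ∀ ω, g ω * (innov κ Y φ k ω ^ 2 + ψ (Y (k + 1) ω)) =
      g ω * (φ (k + 1) (Y (k + 1) ω) ^ 2 + ψ (Y (k + 1) ω)) -
      2 * (g ω * avg (κ k) (φ (k + 1)) (Y k ω) * φ (k + 1) (Y (k + 1) ω)) +
      g ω * avg (κ k) (φ (k + 1)) (Y k ω) ^ 2 := fun ω => by
    simp only [innov]; ring
  have e' : ∀ ω, g ω * (avg (κ k) (fun x => φ (k + 1) x ^ 2 + ψ x) (Y k ω)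
        - avg (κ k) (φ (k + 1)) (Y k ω) ^ 2) =
      g ω * avg (κ k) (fun x => φ (k + 1) x ^ 2 + ψ x) (Y k ω) -
        2 * (g ω * avg (κ k) (φ (k + 1)) (Y k ω) * avg (κ k) (φ (k + 1)) (Y k ω)) +
        g ω * avg (κ k) (φ (k + 1)) (Y k ω) ^ 2 := fun ω => by ring
  simp only [e, e']
  have b2 := (BddMeas.const 2).mul ((bg.mul ba').mul bφ1)
  have b3 := (BddMeas.const 2).mul ((bg.mul ba').mul ba')
  have b4 := bg.mul (ba'.pow 2)
  have b5 := bg.mul (hY.bddMeas' (bχ.avg (κ k)) k)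
  rw [((bg.mul bχ1).sub b2).integral_add b4, (bg.mul bχ1).integral_sub b2,
    (b5.sub b3).integral_add b4, b5.integral_sub b3, integral_const_mul, integral_const_mul,
    hY.markov k _ _ (hg.mul ba) (hφ _), hY.markov k g _ hg bχ]

lemma integral_innov_sq (hY : IsChain P ℱ Y κ) (hφ : ∀ k, BddMeas mE (φ k)) (k : ℕ) :
    ∫ ω, innov κ Y φ k ω ^ 2 ∂P = ∫ ω, φ (k + 1) (Y (k + 1) ω) ^ 2 ∂P -
      ∫ ω, avg (κ k) (φ (k + 1)) (Y k ω) ^ 2 ∂P := by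
  have := hY.integral_mul_innov_sq_add hφ (BddMeas.const (m := mE) 0) k (fun _ => 1) (.const 1)
  simp only [one_mul, add_zero] at this
  have b2 : BddMeas mE (fun x => φ (k + 1) x ^ 2) := (hφ _).pow 2
  rw [this, (hY.bddMeas' (b2.avg (κ k)) k).integral_sub
    ((hY.bddMeas' ((hφ _).avg (κ k)) k).pow 2), ← hY.integral_succ b2 k]

/-- The conditional variance of one step of a contracting chain controls the variance. -/
lemma mul_integral_sq_le (hY : IsChain P ℱ Y κ) (hφ : ∀ k, BddMeas mE (φ k)) {α : ℝ} {k : ℕ}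
    (hα1 : α ≤ 1) (hα : α ≤ alphaCoeff (κ k)) (hmean : ∫ ω, φ (k + 1) (Y (k + 1) ω) ∂P = 0) :
    α * ∫ ω, φ (k + 1) (Y (k + 1) ω) ^ 2 ∂P ≤ 3 * ∫ ω, innov κ Y φ k ω ^ 2 ∂P := by
  set a : E → ℝ := avg (κ k) (φ (k + 1)) with ha
  set b : E → ℝ := avg (κ k) (fun x => φ (k + 1) x ^ 2) with hb
  have ma : BddMeas mE a := (hφ (k + 1)).avg (κ k)
  have mb : BddMeas mE b := ((hφ (k + 1)).pow 2).avg (κ k)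
  have ba := hY.bddMeas' ma k
  have bb := hY.bddMeas' mb k
  have he : ∫ ω, φ (k + 1) (Y (k + 1) ω) ^ 2 ∂P = ∫ ω, b (Y k ω) ∂P :=
    hY.integral_succ ((hφ (k + 1)).pow 2) k
  have hs : ∫ ω, innov κ Y φ k ω ^ 2 ∂P =
      ∫ ω, b (Y k ω) ∂P - ∫ ω, a (Y k ω) ^ 2 ∂P := by
    rw [hY.integral_innov_sq hφ, he]
  have ha0 : ∫ ω, a (Y k ω) ∂P = 0 := by rw [← hY.integral_succ (hφ (k + 1)) k, hmean]
  -- Here `b - a ^ 2` is the conditional variance of one step. The inequality is next averaged over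
  -- `y` and then over `x`, independently with the law of `Y k`; as `a` has mean zero, this gives `α
  -- E[a ^ 2] ≤ 2 E[innov ^ 2]`.
  have pw : ∀ x y, α * (a x - a y) ^ 2 ≤ 2 * (b x - a x ^ 2) + 2 * (b y - a y ^ 2) := by
    intro x y
    have := sq_integral_sub_le (abs_sub_le_of_le_alphaCoeff hα x y) (hφ (k + 1))
    rw [sub_sub_cancel] at this
    exact this
  have p1 : ∀ x, α * (a x ^ 2 + ∫ ω, a (Y k ω) ^ 2 ∂P) ≤
      2 * (b x - a x ^ 2) + 2 * (∫ ω, b (Y k ω) ∂P - ∫ ω, a (Y k ω) ^ 2 ∂P) := by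
    intro x
    have b1 : BddMeas mΩ (fun ω => a x ^ 2 - 2 * a x * a (Y k ω)) :=
      (BddMeas.const _).sub ((BddMeas.const _).mul ba)
    have b2 : BddMeas mΩ (fun ω => b (Y k ω) - a (Y k ω) ^ 2) := bb.sub (ba.pow 2)
    have := integral_mono (μ := P)
      (((BddMeas.const α).mul (b1.add (ba.pow 2))).integrable P)
      (((BddMeas.const (2 * (b x - a x ^ 2))).add ((BddMeas.const 2).mul b2)).integrable P)
      (fun ω => by
        have := pw x (Y k ω)
        show α * (a x ^ 2 - 2 * a x * a (Y k ω) + a (Y k ω) ^ 2) ≤ _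
        convert this using 1
        ring)
    rw [integral_const_mul, b1.integral_add (ba.pow 2),
      (BddMeas.const (m := mΩ) (a x ^ 2)).integral_sub ((BddMeas.const _).mul ba),
      integral_const_mul, ha0,
      (BddMeas.const (m := mΩ) (2 * (b x - a x ^ 2))).integral_add ((BddMeas.const 2).mul b2),
      integral_const_mul 2 (fun ω => b (Y k ω) - a (Y k ω) ^ 2), bb.integral_sub (ba.pow 2)] at this
    simpa using this
  have b2 : BddMeas mΩ (fun ω => b (Y k ω) - a (Y k ω) ^ 2) := bb.sub (ba.pow 2)
  have p2 := integral_mono (μ := P)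
    (((BddMeas.const α).mul ((ba.pow 2).add
      (.const (∫ ω, a (Y k ω) ^ 2 ∂P)))).integrable P)
    ((((BddMeas.const 2).mul b2).add (BddMeas.const
      (2 * (∫ ω, b (Y k ω) ∂P - ∫ ω, a (Y k ω) ^ 2 ∂P)))).integrable P)
    (fun ω => p1 (Y k ω))
  rw [integral_const_mul, (ba.pow 2).integral_add (.const _),
    ((BddMeas.const 2).mul b2).integral_add (.const _), integral_const_mul,
    bb.integral_sub (ba.pow 2)] at p2
  simp only [integral_const, probReal_univ, one_smul] at p2
  have hnn : 0 ≤ ∫ ω, innov κ Y φ k ω ^ 2 ∂P := integral_nonneg fun ω => sq_nonneg _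
  rw [he]
  rw [hs] at hnn ⊢
  nlinarith

end IsChain

end Chain

/-! ### Martingale decomposition with bounds in `α`, and its consequences. -/

section Decomposition

variable {E Ω : Type*} [mE : MeasurableSpace E] {mΩ : MeasurableSpace Ω} {κ : ℕ → Kernel E E}
  {P : Measure Ω} {ℱ : Filtration ℕ mΩ} {Y : ℕ → Ω → E} [∀ k, IsMarkovKernel (κ k)]
  [IsProbabilityMeasure P] {f : ℕ → E → ℝ} {N : ℕ}

/-- The martingale decomposition of a centred sum along a contracting chain, with bounds on the
martingale differences `ξ` and on the conditional variances `U k` that remain at time `k`. -/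
lemma IsChain.exists_martingale_decomposition (hY : IsChain P ℱ Y κ) {x₀ : E}
    (hY0 : ∀ ω, Y 0 ω = x₀) {α C : ℝ} (hα0 : 0 < α) (hα1 : α ≤ 1)
    (hα : ∀ k, α ≤ alphaCoeff (κ k)) (hf : ∀ k, BddMeas mE (f k)) (hC : ∀ k x, |f k x| ≤ C)
    (hmean : ∀ k, ∫ ω, f k (Y k ω) ∂P = 0) (hfN : ∀ k, N ≤ k → ∀ x, f k x = 0) :
    ∃ ξ U : ℕ → Ω → ℝ, (∀ k, BddMeas (ℱ (k + 1)) (ξ k)) ∧ (∀ k, BddMeas (ℱ k) (U k)) ∧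
      (∀ k g, BddMeas (ℱ k) g → ∫ ω, g ω * ξ k ω ∂P = 0) ∧
      (∀ k g, BddMeas (ℱ k) g → ∫ ω, g ω * (ξ k ω ^ 2 + U (k + 1) ω) ∂P =
        ∫ ω, g ω * U k ω ∂P) ∧
      (∀ k ω, |ξ k ω| ≤ 2 * C / α) ∧
      (∀ k ω, |U k ω - ∫ ω', U k ω' ∂P| ≤ 14 * C ^ 2 / α ^ 2) ∧
      (∀ ω, U N ω = 0) ∧
      (∀ ω, ∑ k ∈ Finset.range N, ξ k ω = ∑ k ∈ Finset.range N, f k (Y k ω)) ∧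
      α * ∑ k ∈ Finset.range N, ∫ ω, f (k + 1) (Y (k + 1) ω) ^ 2 ∂P ≤
        12 * ∑ k ∈ Finset.range N, ∫ ω, ξ k ω ^ 2 ∂P := by
  have hC0 : 0 ≤ C := (abs_nonneg _).trans (hC 0 x₀)
  obtain ⟨h, hh, hN⟩ := exists_backward_solution κ f N hfN
  have bh := bddMeas_backward hf hh hN
  have hosc : ∀ k x y, |h k x - h k y| ≤ 2 * C / α :=
    abs_backward_sub_le hα0 hα (by positivity) hf (fun k x y => by
      have := (abs_sub (f k x) (f k y)).trans (add_le_add (hC k x) (hC k y))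
      linarith) hh hN
  have hmean' := hY.integral_backward_eq_zero hf hmean hh hN
  have hsup : ∀ k x, |h k x| ≤ 2 * C / α := fun k x => by
    have := abs_sub_integral_le (μ := P) (hY.bddMeas' (bh k) k) fun ω => hosc k x (Y k ω)
    rwa [hmean', sub_zero] at this
  -- `F k` equals `h k ^ 2 - (avg h (k + 1)) ^ 2`, since `avg h (k + 1) = h k - f k`; in this form
  -- it has only one factor `1 / α`.
  set F : ℕ → E → ℝ := fun k x => 2 * f k x * h k x - f k x ^ 2 with hF
  have bF : ∀ k, BddMeas mE (F k) := fun k =>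
    (((BddMeas.const 2).mul (hf k)).mul (bh k)).sub ((hf k).pow 2)
  have hFabs : ∀ k x, |F k x| ≤ 5 * C ^ 2 / α := fun k x => by
    have h1 : |f k x * h k x| ≤ C * (2 * C / α) := by
      rw [abs_mul]; exact mul_le_mul (hC k x) (hsup k x) (abs_nonneg _) hC0
    have h2 : f k x ^ 2 ≤ C ^ 2 := sq_le_sq.2 ((hC k x).trans (le_abs_self _))
    have h3 : C ^ 2 ≤ C ^ 2 / α := le_div_self (sq_nonneg _) hα0 hα1
    have h4 : 5 * C ^ 2 / α = 2 * (C * (2 * C / α)) + C ^ 2 / α := by field_simp; ring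
    rw [h4, abs_le]
    have h5 := abs_le.1 h1
    have h6 := sq_nonneg (f k x)
    simp only [hF]
    constructor <;> linarith
  obtain ⟨G, hG, hGN⟩ := exists_backward_solution κ F N fun k hk x => by simp [hF, hfN k hk]
  have bG := bddMeas_backward bF hG hGN
  have Gosc : ∀ k x y, |G k x - G k y| ≤ 10 * C ^ 2 / α / α :=
    abs_backward_sub_le hα0 hα (by positivity) bF (fun k x y => by
      have := (abs_sub (F k x) (F k y)).trans (add_le_add (hFabs k x) (hFabs k y))
      refine this.trans (le_of_eq ?_); ring) hG hGN
  have havg : ∀ k x, |avg (κ k) (h (k + 1)) x| ≤ 2 * C / α := fun k x => by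
    have := abs_sub_integral_le (μ := κ k x) (bh (k + 1)) (a := 0) (r := 2 * C / α) fun y => by
      rw [zero_sub, abs_neg]; exact hsup _ y
    rwa [zero_sub, abs_neg] at this
  -- `u k` is the conditional mean of the squared innovations from time `k` on: by `hGu` below, `G k
  -- = h k ^ 2 + u k`, which is the required recursion.
  set u : ℕ → E → ℝ := fun k x => avg (κ k) (G (k + 1)) x - avg (κ k) (h (k + 1)) x ^ 2 with hu
  have bu : ∀ k, BddMeas mE (u k) := fun k =>
    ((bG _).avg (κ k)).sub (((bh _).avg (κ k)).pow 2)
  have uosc : ∀ k x y, |u k x - u k y| ≤ 14 * C ^ 2 / α ^ 2 := fun k x y => by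
    have h1 := abs_avg_sub_avg_le (hα k) (bG (k + 1)) (Gosc (k + 1)) x y
    have h2 : (1 - α) * (10 * C ^ 2 / α / α) ≤ 10 * C ^ 2 / α / α :=
      mul_le_of_le_one_left (by positivity) (by linarith)
    have h3 : ∀ z, avg (κ k) (h (k + 1)) z ^ 2 ≤ (2 * C / α) ^ 2 := fun z =>
      sq_le_sq.2 ((havg k z).trans (le_abs_self _))
    have h4 : 14 * C ^ 2 / α ^ 2 = 10 * C ^ 2 / α / α + (2 * C / α) ^ 2 := by field_simp; ring
    have h5 := abs_le.1 (h1.trans h2)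
    rw [h4, abs_le]
    simp only [hu]
    constructor <;> linarith [h3 x, h3 y, sq_nonneg (avg (κ k) (h (k + 1)) x),
      sq_nonneg (avg (κ k) (h (k + 1)) y)]
  have hGu : ∀ k, (fun x => h k x ^ 2 + u k x) = G k := fun k => by
    funext x
    have := hh k x
    rw [hG k x]
    simp only [hu, hF]
    rw [show avg (κ k) (h (k + 1)) x = h k x - f k x by linarith]
    ring
  have hzero : ∀ {φ : ℕ → E → ℝ} {k : ℕ}, (∀ k, N ≤ k → ∀ x, φ k x = 0) → N ≤ k → ∀ x,
      avg (κ k) (φ (k + 1)) x = 0 := fun {φ k} hφ hk x => by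
    simp [avg, hφ (k + 1) (by omega)]
  refine ⟨innov κ Y h, fun k ω => u k (Y k ω), hY.bddMeas_innov bh,
    fun k => hY.bddMeas (bu k) k, hY.integral_mul_innov bh, fun k g hg => ?_, fun k ω => ?_,
    fun k ω => ?_, fun ω => ?_, fun ω => ?_, ?_⟩
  · rw [hY.integral_mul_innov_sq_add bh (bu (k + 1)) k g hg, hGu]
  · exact abs_sub_integral_le (bh (k + 1)) fun y => hosc _ _ _
  · exact abs_sub_integral_le (hY.bddMeas' (bu k) k) fun ω' => uosc _ _ _
  · simp only [hu, hzero hGN le_rfl, hzero hN le_rfl]; norm_num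
  -- The state at time `0` is deterministic, so mean zero means value zero and the telescoping sum
  -- leaves no boundary term.
  · have h0 : h 0 x₀ = 0 := by
      have := hmean' 0
      simpa [hY0] using this
    have e : ∀ k, innov κ Y h k ω =
        (h (k + 1) (Y (k + 1) ω) - h k (Y k ω)) + f k (Y k ω) := fun k => by
      have := hh k (Y k ω)
      simp only [innov]
      linarith
    simp only [e]
    rw [Finset.sum_add_distrib, Finset.sum_range_sub (fun k => h k (Y k ω)), hY0, h0,
      hN N le_rfl, sub_zero, zero_add]
  · set e : ℕ → ℝ := fun k => ∫ ω, h k (Y k ω) ^ 2 ∂P with he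
    have he0 : ∀ k, 0 ≤ e k := fun k => integral_nonneg fun ω => sq_nonneg _
    have heN : e (N + 1) = 0 := by simp [he, hN (N + 1) (by omega)]
    -- From `f k = h k - avg h (k + 1)`, and `E[(avg h (k + 1)) ^ 2] ≤ e (k + 1)` because the
    -- innovation has nonnegative second moment.
    have s1 : ∀ k, ∫ ω, f k (Y k ω) ^ 2 ∂P ≤ 2 * e k + 2 * e (k + 1) := fun k => by
      have b1 := (hY.bddMeas' (bh k) k).pow 2
      have b2 := (hY.bddMeas' ((bh (k + 1)).avg (κ k)) k).pow 2
      have i1 := integral_mono (μ := P) (((hY.bddMeas' (hf k) k).pow 2).integrable P)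
        ((((BddMeas.const 2).mul b1).add ((BddMeas.const 2).mul b2)).integrable P) (fun ω => by
          have := hh k (Y k ω)
          show f k (Y k ω) ^ 2 ≤ 2 * h k (Y k ω) ^ 2 + 2 * avg (κ k) (h (k + 1)) (Y k ω) ^ 2
          rw [this]
          nlinarith [sq_nonneg (f k (Y k ω) + 2 * avg (κ k) (h (k + 1)) (Y k ω))])
      rw [((BddMeas.const 2).mul b1).integral_add ((BddMeas.const 2).mul b2), integral_const_mul,
        integral_const_mul] at i1
      have i2 := hY.integral_innov_sq bh k
      have i3 : 0 ≤ ∫ ω, innov κ Y h k ω ^ 2 ∂P := integral_nonneg fun ω => sq_nonneg _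
      simp only [he]
      linarith
    have s2 : ∀ k, α * e (k + 1) ≤ 3 * ∫ ω, innov κ Y h k ω ^ 2 ∂P := fun k =>
      hY.mul_integral_sq_le bh hα1 (hα k) (hmean' (k + 1))
    have s3 : ∑ k ∈ Finset.range N, e (k + 1 + 1) ≤ ∑ k ∈ Finset.range N, e (k + 1) := by
      have := Finset.sum_range_sub (fun k => e (k + 1)) N
      rw [Finset.sum_sub_distrib, heN] at this
      linarith [he0 (0 + 1)]
    calc _ ≤ α * ∑ k ∈ Finset.range N, (2 * e (k + 1) + 2 * e (k + 1 + 1)) :=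
          mul_le_mul_of_nonneg_left (Finset.sum_le_sum fun k _ => s1 (k + 1)) hα0.le
      _ ≤ α * (4 * ∑ k ∈ Finset.range N, e (k + 1)) := by
          refine mul_le_mul_of_nonneg_left ?_ hα0.le
          rw [Finset.sum_add_distrib, ← Finset.mul_sum, ← Finset.mul_sum]
          linarith
      _ = 4 * ∑ k ∈ Finset.range N, α * e (k + 1) := by rw [← Finset.mul_sum]; ring
      _ ≤ 4 * ∑ k ∈ Finset.range N, 3 * ∫ ω, innov κ Y h k ω ^ 2 ∂P := by
          exact mul_le_mul_of_nonneg_left (Finset.sum_le_sum fun k _ => s2 k) (by norm_num)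
      _ = _ := by rw [← Finset.mul_sum]; ring

lemma integral_abs_le_of_sq_le {F : Ω → ℝ} (hF : BddMeas mΩ F) {r : ℝ} (hr : 0 ≤ r)
    (h : ∫ ω, F ω ^ 2 ∂P ≤ r ^ 2) : ∫ ω, |F ω| ∂P ≤ r := by
  have hA : BddMeas mΩ (fun ω => |F ω|) := by
    obtain ⟨hm, B, hB⟩ := hF
    exact ⟨hm.abs, B, fun x => by rw [abs_abs]; exact hB x⟩
  set m := ∫ ω, |F ω| ∂P with hm
  have e : ∀ ω, (|F ω| - m) ^ 2 = (F ω ^ 2 - 2 * m * |F ω|) + m ^ 2 := fun ω => by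
    rw [sub_sq, sq_abs]; ring
  have h0 : 0 ≤ ∫ ω, (|F ω| - m) ^ 2 ∂P := integral_nonneg fun ω => sq_nonneg _
  have b1 := (BddMeas.const (2 * m)).mul hA
  simp only [e] at h0
  rw [((hF.pow 2).sub b1).integral_add (.const _), (hF.pow 2).integral_sub b1,
    integral_const_mul, ← hm] at h0
  simp only [integral_const, probReal_univ, one_smul] at h0
  exact abs_le_of_sq_le_sq' (by nlinarith) hr |>.2

/-- A centred sum along a contracting chain: a lower bound for the variance, and the distance of
the characteristic function to the Gaussian one. -/
theorem IsChain.variance_and_charFun_bounds (hY : IsChain P ℱ Y κ) {x₀ : E}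
    (hY0 : ∀ ω, Y 0 ω = x₀) {α C : ℝ} (hα0 : 0 < α) (hα1 : α ≤ 1)
    (hα : ∀ k, α ≤ alphaCoeff (κ k)) (hf : ∀ k, BddMeas mE (f k)) (hC : ∀ k x, |f k x| ≤ C)
    (hmean : ∀ k, ∫ ω, f k (Y k ω) ∂P = 0) (hfN : ∀ k, N ≤ k → ∀ x, f k x = 0) {V : ℝ}
    (hV : ∫ ω, (∑ k ∈ Finset.range N, f k (Y k ω)) ^ 2 ∂P = V) :
    α * ∑ k ∈ Finset.range N, ∫ ω, f (k + 1) (Y (k + 1) ω) ^ 2 ∂P ≤ 12 * V ∧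
    ∀ t : ℝ, 0 < V → |t| * (2 * (C / (α * √V))) ≤ 1 →
      ‖∫ ω, Complex.exp ((t / √V * ∑ k ∈ Finset.range N, f k (Y k ω) : ℝ) * Complex.I) ∂P -
        Real.exp (-(t ^ 2 / 2))‖ ≤
      (2 * (t ^ 2 + 1) + 1 + Real.exp (t ^ 2 + 2)) *
        ((2 * |t| + 6 * t ^ 2) * (C / (α * √V))) := by
  have hC0 : 0 ≤ C := (abs_nonneg _).trans (hC 0 x₀)
  obtain ⟨ξ, U, bξ, bU, hmart, hcond, hξ, hU, hUN, hsum, hlow⟩ :=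
    hY.exists_martingale_decomposition hY0 hα0 hα1 hα hf hC hmean hfN
  have hVs : ∑ k ∈ Finset.range N, ∫ ω, ξ k ω ^ 2 ∂P = V := by
    rw [← integral_sq_sum_eq bξ hmart, ← hV]; simp only [hsum]
  have hU0 : ∫ ω, U 0 ω ∂P = V := by
    rw [integral_eq_sum_of_cond bξ bU hcond N, hVs]; simp [hUN]
  refine ⟨by rw [← hVs]; exact hlow, fun t hVpos ht => ?_⟩
  have hσ : 0 < √V := Real.sqrt_pos.2 hVpos
  have hσ2 : √V ^ 2 = V := Real.sq_sqrt hVpos.le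
  set q := C / (α * √V) with hq
  have hq0 : 0 ≤ q := by positivity
  set s := t / √V with hs
  have hs2 : s ^ 2 * V = t ^ 2 := by rw [hs, div_pow, hσ2]; field_simp
  have hQ := integral_sq_sum_sq_sub_le bξ bU hcond hξ hU hUN
  rw [hU0] at hQ
  have bQ : BddMeas mΩ (fun ω => ∑ k ∈ Finset.range N, ξ k ω ^ 2 - V) :=
    (BddMeas.sum _ fun k _ => ((bξ k).mono (ℱ.le _)).pow 2).sub (.const _)
  have hL1 : ∫ ω, |∑ k ∈ Finset.range N, (s * ξ k ω) ^ 2 - t ^ 2| ∂P ≤ 6 * t ^ 2 * q := by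
    have e : ∀ ω, ∑ k ∈ Finset.range N, (s * ξ k ω) ^ 2 - t ^ 2 =
        s ^ 2 * (∑ k ∈ Finset.range N, ξ k ω ^ 2 - V) := fun ω => by
      rw [mul_sub, hs2, Finset.mul_sum]; simp only [mul_pow]
    simp only [e]
    refine integral_abs_le_of_sq_le ((BddMeas.const (s ^ 2)).mul bQ) (by positivity) ?_
    simp only [mul_pow]
    rw [integral_const_mul]
    -- The constant is `32 = 2 ^ 2 + 2 * 14`, later rounded up to `6 ^ 2`.
    have h1 : ((2 * C / α) ^ 2 + 2 * (14 * C ^ 2 / α ^ 2)) * V = 32 * q ^ 2 * V ^ 2 := by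
      have hq2 : q ^ 2 = C ^ 2 / (α ^ 2 * V) := by rw [hq, div_pow, mul_pow, hσ2]
      rw [hq2]; field_simp; ring
    rw [h1] at hQ
    calc (s ^ 2) ^ 2 * ∫ ω, (∑ k ∈ Finset.range N, ξ k ω ^ 2 - V) ^ 2 ∂P
        ≤ (s ^ 2) ^ 2 * (32 * q ^ 2 * V ^ 2) := by gcongr
      _ = 32 * ((s ^ 2 * V) ^ 2 * q ^ 2) := by ring
      _ = 32 * (t ^ 2) ^ 2 * q ^ 2 := by rw [hs2]; ring
      _ ≤ 6 ^ 2 * (t ^ 2) ^ 2 * q ^ 2 := by gcongr; norm_num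
  have main := norm_integral_cexp_sub_le (P := P) (ℱ := ℱ) (ξ := fun k ω => s * ξ k ω)
    (fun k => (BddMeas.const s).mul (bξ k)) (fun k g hg => by
      have := hmart k _ ((BddMeas.const s).mul hg)
      rw [← this]; congr 1; funext ω; ring) (sq_nonneg t) ht (fun k ω => by
      rw [abs_mul]
      refine (mul_le_mul_of_nonneg_left (hξ k ω) (abs_nonneg _)).trans (le_of_eq ?_)
      rw [hs, hq, abs_div, abs_of_pos hσ]; field_simp) N
  simp only [← Finset.mul_sum, hsum] at main
  refine main.trans (mul_le_mul_of_nonneg_left ?_ (by positivity))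
  linarith

end Decomposition

/-! ### From the finite Markov chain to a chain in infinite time. -/

section Bridge

variable {E Ω : Type*} [mE : MeasurableSpace E] {mΩ : MeasurableSpace Ω} {P : Measure Ω}
  {n : ℕ} {μ : Measure E} {π : ℕ → Kernel E E} {X : ℕ → Ω → E}

lemma history_mono (X : ℕ → Ω → E) {i j : ℕ} (hij : i ≤ j) : history X i ≤ history X j :=
  biSup_mono fun _ hk => Finset.Icc_subset_Icc_right hij hk

lemma history_zero (X : ℕ → Ω → E) : history X 0 = ⊥ := by
  simp [history]

lemma IsMarkovChain.history_le (hX : IsMarkovChain n μ π P X) {i : ℕ} (hi : i ≤ n) :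
    history X i ≤ mΩ := by
  refine iSup₂_le fun j hj => ?_
  rw [Finset.mem_Icc] at hj
  exact (hX.measurable j hj.1 (hj.2.trans hi)).comap_le

lemma measurable_history (X : ℕ → Ω → E) {i : ℕ} (hi : 1 ≤ i) :
    Measurable[history X i] (X i) :=
  Measurable.mono (comap_measurable (X i))
    (le_iSup₂_of_le i (Finset.mem_Icc.2 ⟨hi, le_rfl⟩) le_rfl) le_rfl

lemma measurable_chainSum (hX : 1 ≤ n → IsMarkovChain n μ π P X) {f : ℕ → E → ℝ}
    (hf : ∀ i, 1 ≤ i → i ≤ n → Measurable (f i)) : Measurable (chainSum n f X) := by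
  refine Finset.measurable_fun_sum _ fun i hi => ?_
  rw [Finset.mem_Icc] at hi
  exact (hf i hi.1 hi.2).comp ((hX (hi.1.trans hi.2)).measurable i hi.1 hi.2)

variable [IsProbabilityMeasure P]

lemma IsMarkovChain.setIntegral_eq (hX : IsMarkovChain n μ π P X) {i : ℕ} (hi : 1 ≤ i)
    (hin : i < n) [IsMarkovKernel (π i)] {φ : E → ℝ} (hφ : BddMeas mE φ) {B : Set Ω}
    (hB : MeasurableSet[history X i] B) :
    ∫ ω in B, avg (π i) φ (X i ω) ∂P = ∫ ω in B, φ (X (i + 1) ω) ∂P := by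
  have hm := hX.history_le hin.le
  have mX := hX.measurable i hi hin.le
  have mX' := hX.measurable (i + 1) (by omega) hin
  set ν := (P.restrict B).map (X i) with hν
  -- On an event of the past, the law of `X (i + 1)` is the law of `X i` pushed through `π i`. This
  -- identity of finite measures carries the Markov property from sets to bounded functions.
  have key : ((π i) ∘ₖ Kernel.const Unit ν) () = (P.restrict B).map (X (i + 1)) := by
    ext A hA
    rw [Kernel.comp_apply' _ _ _ hA, Kernel.const_apply, hν,
      lintegral_map (Kernel.measurable_coe _ hA) mX, Measure.map_apply mX' hA,
      Measure.restrict_apply (mX' hA)]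
    have h1 : ∫ ω in B, (π i (X i ω)).real A ∂P = P.real (X (i + 1) ⁻¹' A ∩ B) := by
      have e := setIntegral_condExp hm (μ := P)
        (f := (X (i + 1) ⁻¹' A).indicator fun _ => (1 : ℝ))
        ((integrable_const 1).indicator (mX' hA)) hB
      have e' : ∫ ω in B, (π i (X i ω)).real A ∂P =
          ∫ ω in B, (P⟦X (i + 1) ⁻¹' A | history X i⟧) ω ∂P :=
        integral_congr_ae (ae_restrict_of_ae ((hX.markov i hi hin A hA).symm))
      rw [e', e, integral_indicator (mX' hA)]
      simp [measureReal_restrict_apply (mX' hA)]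
    have h2 : ∫⁻ ω in B, π i (X i ω) A ∂P = ENNReal.ofReal (∫ ω in B, (π i (X i ω)).real A ∂P) := by
      have mA : BddMeas mΩ (fun ω => (π i (X i ω)).real A) :=
        ⟨((Kernel.measurable_coe (π i) hA).comp mX).ennreal_toReal, 1, fun ω => by
          rw [abs_of_nonneg measureReal_nonneg]; exact measureReal_le_one⟩
      rw [ofReal_integral_eq_lintegral_ofReal (mA.integrable _)
        (ae_of_all _ fun ω => measureReal_nonneg)]
      simp
    rw [h2, h1]
    simp
  have hint : Integrable φ (((π i) ∘ₖ Kernel.const Unit ν) ()) := by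
    rw [key]; exact hφ.integrable _
  have := Kernel.integral_comp hint
  rw [key, integral_map mX'.aemeasurable hφ.1.aestronglyMeasurable, Kernel.const_apply] at this
  exact ((integral_map mX.aemeasurable (hφ.avg (π i)).1.aestronglyMeasurable).symm.trans
    this.symm)

lemma IsMarkovChain.integral_mul_eq (hX : IsMarkovChain n μ π P X) {i : ℕ} (hi : 1 ≤ i)
    (hin : i < n) [IsMarkovKernel (π i)] {φ : E → ℝ} (hφ : BddMeas mE φ) {g : Ω → ℝ}
    (hg : BddMeas (history X i) g) :
    ∫ ω, g ω * φ (X (i + 1) ω) ∂P = ∫ ω, g ω * avg (π i) φ (X i ω) ∂P := by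
  have hm := hX.history_le hin.le
  have bφ : BddMeas mΩ (fun ω => φ (X (i + 1) ω)) :=
    hφ.comp (hX.measurable (i + 1) (by omega) hin)
  have ba : BddMeas (history X i) (fun ω => avg (π i) φ (X i ω)) :=
    (hφ.avg (π i)).comp (measurable_history X hi)
  have hcond : (fun ω => avg (π i) φ (X i ω)) =ᵐ[P]
      P[fun ω => φ (X (i + 1) ω) | history X i] :=
    ae_eq_condExp_of_forall_setIntegral_eq hm (bφ.integrable P)
      (fun s _ _ => ((ba.mono hm).integrable P).integrableOn)
      (fun s hs _ => hX.setIntegral_eq hi hin hφ hs) ba.1.stronglyMeasurable.aestronglyMeasurable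
  have pull := condExp_mul_of_stronglyMeasurable_left (μ := P) (m := history X i) (f := g)
    (g := fun ω => φ (X (i + 1) ω)) hg.1.stronglyMeasurable
    (((hg.mono hm).mul bφ).integrable P) (bφ.integrable P)
  calc ∫ ω, g ω * φ (X (i + 1) ω) ∂P
      = ∫ ω, (P[g * fun ω => φ (X (i + 1) ω) | history X i]) ω ∂P :=
        (integral_condExp hm).symm
    _ = ∫ ω, g ω * avg (π i) φ (X i ω) ∂P := by
        refine integral_congr_ae ?_
        filter_upwards [pull, hcond] with ω h1 h2
        rw [h1, Pi.mul_apply, h2]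

/-- The filtration of a finite chain, constant after the last time. -/
def IsMarkovChain.filtration (hX : IsMarkovChain n μ π P X) : Filtration ℕ mΩ where
  seq k := history X (min k n)
  mono' _ _ hij := history_mono X (min_le_min_right n hij)
  le' k := hX.history_le (min_le_right k n)

/-- The chain, put in the state `x₀` at time `0` and after the last time. -/
def extendChain (n : ℕ) (x₀ : E) (X : ℕ → Ω → E) (k : ℕ) (ω : Ω) : E :=
  if 1 ≤ k ∧ k ≤ n then X k ω else x₀

/-- The transition probabilities of the extended chain. -/
noncomputable def extendKernel (n : ℕ) (x₀ : E) (ρ : Measure E) (π : ℕ → Kernel E E) (k : ℕ) :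
    Kernel E E :=
  if 1 ≤ k ∧ k < n then π k else
    if k = 0 then Kernel.const E ρ else Kernel.const E (Measure.dirac x₀)

lemma isMarkovKernel_extendKernel (hπ : ∀ i, 1 ≤ i → i < n → IsMarkovKernel (π i)) (x₀ : E)
    (ρ : Measure E) [IsProbabilityMeasure ρ] (k : ℕ) :
    IsMarkovKernel (extendKernel n x₀ ρ π k) := by
  unfold extendKernel
  split_ifs with h
  · exact hπ k h.1 h.2
  · infer_instance
  · infer_instance

lemma le_alphaCoeff_extendKernel {α : ℝ} (hα1 : α ≤ 1)
    (hα : ∀ i, 1 ≤ i → i < n → α ≤ alphaCoeff (π i)) (x₀ : E) (ρ : Measure E) (k : ℕ) :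
    α ≤ alphaCoeff (extendKernel n x₀ ρ π k) := by
  unfold extendKernel
  split_ifs with h
  · exact hα k h.1 h.2
  · exact hα1.trans (alphaCoeff_const _)
  · exact hα1.trans (alphaCoeff_const _)

lemma IsMarkovChain.isChain_extend (hX : IsMarkovChain n μ π P X) (hn : 1 ≤ n)
    (hπ : ∀ i, 1 ≤ i → i < n → IsMarkovKernel (π i)) (x₀ : E) :
    IsChain P hX.filtration (extendChain n x₀ X) (extendKernel n x₀ (P.map (X 1)) π) where
  measurable k := by
    by_cases h : 1 ≤ k ∧ k ≤ n
    · have e : extendChain n x₀ X k = X k := funext fun ω => if_pos h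
      have e' : hX.filtration k = history X k := by
        show history X (min k n) = _
        rw [min_eq_left h.2]
      rw [e, e']
      exact measurable_history X h.1
    · have e : extendChain n x₀ X k = fun _ => x₀ := funext fun ω => if_neg h
      rw [e]
      exact measurable_const
  markov k g φ hg hφ := by
    rcases Nat.eq_zero_or_pos k with rfl | hk
    · have mX := hX.measurable 1 le_rfl hn
      -- The history at time `0` is trivial, so `g` is constant.
      obtain ⟨r, hr⟩ : ∃ r, g = fun _ => r := by
        have h0 : hX.filtration 0 = ⊥ := by
          show history X (min 0 n) = _
          rw [Nat.zero_min, history_zero]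
        rw [h0] at hg
        have : Nonempty Ω := nonempty_of_isProbabilityMeasure P
        obtain ⟨r, hr⟩ := stronglyMeasurable_bot_iff.1 hg.1.stronglyMeasurable
        exact ⟨r, hr⟩
      have e1 : ∀ ω, extendChain n x₀ X (0 + 1) ω = X 1 ω := fun ω => if_pos ⟨le_rfl, hn⟩
      have e2 : ∀ x, avg (extendKernel n x₀ (P.map (X 1)) π 0) φ x = ∫ ω, φ (X 1 ω) ∂P := by
        intro x
        simp only [avg, extendKernel]
        rw [if_neg (by omega), if_pos trivial, Kernel.const_apply,
          integral_map mX.aemeasurable hφ.1.aestronglyMeasurable]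
      simp only [hr, e1, e2, integral_const_mul]
      simp
    · rcases lt_or_ge k n with hkn | hkn
      · have := hπ k hk hkn
        have e1 : ∀ ω, extendChain n x₀ X (k + 1) ω = X (k + 1) ω :=
          fun ω => if_pos ⟨by omega, hkn⟩
        have e2 : ∀ ω, extendChain n x₀ X k ω = X k ω := fun ω => if_pos ⟨hk, hkn.le⟩
        have e3 : extendKernel n x₀ (P.map (X 1)) π k = π k := if_pos ⟨hk, hkn⟩
        simp only [e1, e2, e3]
        refine hX.integral_mul_eq hk hkn hφ ?_
        have e' : hX.filtration k = history X k := by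
          show history X (min k n) = _
          rw [min_eq_left hkn.le]
        rwa [e'] at hg
      · have e1 : ∀ ω, extendChain n x₀ X (k + 1) ω = x₀ := fun ω => if_neg (by omega)
        have e2 : ∀ x, avg (extendKernel n x₀ (P.map (X 1)) π k) φ x = φ x₀ := by
          intro x
          simp only [avg, extendKernel]
          rw [if_neg (by omega), if_neg (by omega), Kernel.const_apply,
            integral_dirac' _ _ hφ.1.stronglyMeasurable]
        simp only [e1, e2]

/-- Lower bound for the variance of `S_n`, and the distance of the characteristic function of the
normalized sum to the Gaussian one. -/
theorem IsMarkovChain.variance_and_charFun_bounds (hX : IsMarkovChain n μ π P X) (hn : 1 ≤ n)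
    (hπ : ∀ i, 1 ≤ i → i < n → IsMarkovKernel (π i)) {f : ℕ → E → ℝ}
    (hf : ∀ i, 1 ≤ i → i ≤ n → Measurable (f i)) {C c α : ℝ}
    (hC : ∀ i, 1 ≤ i → i ≤ n → ∀ x, |f i x| ≤ C)
    (hvar : ∀ i, 1 ≤ i → i ≤ n → c ≤ variance (fun ω => f i (X i ω)) P)
    (hα0 : 0 < α) (hα1 : α ≤ 1) (hα : ∀ i, 1 ≤ i → i < n → α ≤ alphaCoeff (π i)) {V : ℝ}
    (hV : variance (chainSum n f X) P = V) :
    α * (n * c) ≤ 12 * V ∧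
    ∀ t : ℝ, 0 < V → |t| * (2 * (2 * C / (α * √V))) ≤ 1 →
      ‖∫ ω, Complex.exp ((t / √V * (chainSum n f X ω - ∫ ω', chainSum n f X ω' ∂P) : ℝ) *
          Complex.I) ∂P - Real.exp (-(t ^ 2 / 2))‖ ≤
      (2 * (t ^ 2 + 1) + 1 + Real.exp (t ^ 2 + 2)) *
        ((2 * |t| + 6 * t ^ 2) * (2 * C / (α * √V))) := by
  have : Nonempty Ω := nonempty_of_isProbabilityMeasure P
  have x₀ : E := X 1 (Classical.arbitrary Ω)
  have hC0 : 0 ≤ C := (abs_nonneg _).trans (hC 1 le_rfl hn x₀)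
  have mX1 := hX.measurable 1 le_rfl hn
  have : IsProbabilityMeasure (P.map (X 1)) := Measure.isProbabilityMeasure_map mX1.aemeasurable
  have := isMarkovKernel_extendKernel hπ x₀ (P.map (X 1))
  have bf : ∀ i, 1 ≤ i → i ≤ n → BddMeas mE (f i) := fun i h1 h2 => ⟨hf i h1 h2, C, hC i h1 h2⟩
  have bfX : ∀ i, 1 ≤ i → i ≤ n → BddMeas mΩ (fun ω => f i (X i ω)) := fun i h1 h2 =>
    (bf i h1 h2).comp (hX.measurable i h1 h2)
  set m : ℕ → ℝ := fun i => ∫ ω, f i (X i ω) ∂P with hm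
  have hmC : ∀ i, 1 ≤ i → i ≤ n → |m i| ≤ C := fun i h1 h2 => by
    have := abs_sub_integral_le (μ := P) (bfX i h1 h2) (a := 0) (r := C) fun ω => by
      rw [zero_sub, abs_neg]; exact hC i h1 h2 _
    rwa [zero_sub, abs_neg] at this
  -- Centring doubles the bound to `2 * C`; the padded times contribute nothing.
  set F : ℕ → E → ℝ := fun i x => if 1 ≤ i ∧ i ≤ n then f i x - m i else 0 with hF
  have F1 : ∀ {i}, 1 ≤ i ∧ i ≤ n → F i = fun x => f i x - m i := fun h =>
    funext fun x => if_pos h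
  have F0 : ∀ {i}, ¬(1 ≤ i ∧ i ≤ n) → F i = fun _ => 0 := fun h => funext fun x => if_neg h
  have Y1 : ∀ {i}, 1 ≤ i ∧ i ≤ n → extendChain n x₀ X i = X i := fun h =>
    funext fun ω => if_pos h
  have bF : ∀ i, BddMeas mE (F i) := fun i => by
    by_cases h : 1 ≤ i ∧ i ≤ n
    · rw [F1 h]; exact (bf i h.1 h.2).sub (.const _)
    · rw [F0 h]; exact .const 0
  have hFC : ∀ i x, |F i x| ≤ 2 * C := fun i x => by
    by_cases h : 1 ≤ i ∧ i ≤ n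
    · rw [F1 h]
      have := (abs_sub (f i x) (m i)).trans (add_le_add (hC i h.1 h.2 x) (hmC i h.1 h.2))
      linarith
    · rw [F0 h, abs_zero]; positivity
  have hmean : ∀ i, ∫ ω, F i (extendChain n x₀ X i ω) ∂P = 0 := fun i => by
    by_cases h : 1 ≤ i ∧ i ≤ n
    · rw [F1 h, Y1 h, (bfX i h.1 h.2).integral_sub (.const _)]; simp [hm]
    · rw [F0 h]; simp
  have hFN : ∀ k, n + 1 ≤ k → ∀ x, F k x = 0 := fun k hk x => by rw [F0 (by omega)]
  have hS : ∀ ω, ∑ k ∈ Finset.range (n + 1), F k (extendChain n x₀ X k ω) =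
      chainSum n f X ω - ∫ ω', chainSum n f X ω' ∂P := fun ω => by
    have e1 : ∫ ω', chainSum n f X ω' ∂P = ∑ i ∈ Finset.Icc 1 n, m i :=
      integral_finsetSum _ fun i hi =>
        (bfX i (Finset.mem_Icc.1 hi).1 (Finset.mem_Icc.1 hi).2).integrable P
    rw [e1, chainSum, ← Finset.sum_sub_distrib]
    have sub : Finset.Icc 1 n ⊆ Finset.range (n + 1) := fun i hi => by
      rw [Finset.mem_Icc] at hi; rw [Finset.mem_range]; omega
    rw [← Finset.sum_subset sub fun i _ hi => by
      rw [Finset.mem_Icc] at hi; rw [F0 hi]]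
    refine Finset.sum_congr rfl fun i hi => ?_
    rw [Finset.mem_Icc] at hi
    rw [F1 hi, Y1 hi]
  have hV' : ∫ ω, (∑ k ∈ Finset.range (n + 1), F k (extendChain n x₀ X k ω)) ^ 2 ∂P = V := by
    rw [← hV, variance_eq_integral (measurable_chainSum (fun _ => hX) hf).aemeasurable]
    simp only [hS]
  have main := (hX.isChain_extend hn hπ x₀).variance_and_charFun_bounds (x₀ := x₀)
    (fun ω => if_neg (by omega)) hα0 hα1 (le_alphaCoeff_extendKernel hα1 hα x₀ _) bF hFC hmean
    hFN hV'
  refine ⟨le_trans (mul_le_mul_of_nonneg_left ?_ hα0.le) main.1, fun t ht ht' => ?_⟩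
  -- The shifted sum runs over times `1, …, n + 1`; the last one is padding and is dropped.
  · rw [Finset.sum_range_succ]
    refine le_add_of_le_of_nonneg ?_ (integral_nonneg fun ω => sq_nonneg _)
    have : ∑ _k ∈ Finset.range n, c = n * c := by simp
    rw [← this]
    refine Finset.sum_le_sum fun k hk => ?_
    have hk' : 1 ≤ k + 1 ∧ k + 1 ≤ n := ⟨by omega, Finset.mem_range.1 hk⟩
    refine (hvar (k + 1) hk'.1 hk'.2).trans (le_of_eq ?_)
    rw [variance_eq_integral (bfX _ hk'.1 hk'.2).1.aemeasurable, F1 hk', Y1 hk']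
  · have := main.2 t ht ht'
    simp only [hS] at this
    exact this

end Bridge

lemma minAlpha_le {E : Type*} [MeasurableSpace E] {n : ℕ} {π : ℕ → Kernel E E} {i : ℕ}
    (h1 : 1 ≤ i) (h2 : i < n) : minAlpha n π ≤ alphaCoeff (π i) := by
  have : {i : ℕ | 1 ≤ i ∧ i < n}.Finite := (Set.finite_Iio n).subset fun i hi => hi.2
  exact csInf_le (this.image _).bddBelow ⟨i, ⟨h1, h2⟩, rfl⟩

end DobrushinCLT

/-! ### The limit. -/

theorem corollary1 {E : Type*} [MeasurableSpace E]
    {Ω : ℕ → Type*} [∀ n, MeasurableSpace (Ω n)]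
    (P : (n : ℕ) → Measure (Ω n)) [∀ n, IsProbabilityMeasure (P n)]
    (μ : ℕ → Measure E) (π : ℕ → ℕ → Kernel E E)
    (hπ : ∀ n i, 1 ≤ i → i < n → IsMarkovKernel (π n i))
    (X : (n : ℕ) → ℕ → Ω n → E)
    (hX : ∀ n, 1 ≤ n → DobrushinCLT.IsMarkovChain n (μ n) (π n) (P n) (X n))
    (f : ℕ → ℕ → E → ℝ)
    (hf : ∀ n i, 1 ≤ i → i ≤ n → Measurable (f n i))
    (C : ℝ) (hC : ∀ n i, 1 ≤ i → i ≤ n → ∀ x, |f n i x| ≤ C)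
    (c : ℝ) (hc : 0 < c)
    (hvar : ∀ n i, 1 ≤ i → i ≤ n →
      c ≤ variance (fun ω => f n i (X n i ω)) (P n))
    (hα : Tendsto (fun n : ℕ => (n : ℝ) ^ ((1 : ℝ) / 3) * DobrushinCLT.minAlpha n (π n))
      atTop atTop) :
    TendstoInDistribution
      (fun (n : ℕ) (ω : Ω n) =>
        (DobrushinCLT.chainSum n (f n) (X n) ω
            - ∫ ω', DobrushinCLT.chainSum n (f n) (X n) ω' ∂(P n))
          / √(variance (DobrushinCLT.chainSum n (f n) (X n)) (P n)))
      atTop (id : ℝ → ℝ) P (gaussianReal 0 1) := by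
  have mS : ∀ n, Measurable (DobrushinCLT.chainSum n (f n) (X n)) := fun n =>
    DobrushinCLT.measurable_chainSum (hX n) (hf n)
  have mZ : ∀ n, Measurable (fun ω => (DobrushinCLT.chainSum n (f n) (X n) ω
      - ∫ ω', DobrushinCLT.chainSum n (f n) (X n) ω' ∂(P n))
        / √(variance (DobrushinCLT.chainSum n (f n) (X n)) (P n))) := fun n =>
    ((mS n).sub_const _).div_const _
  set α : ℕ → ℝ := fun n => DobrushinCLT.minAlpha n (π n) with hαdef
  set V : ℕ → ℝ := fun n => variance (DobrushinCLT.chainSum n (f n) (X n)) (P n) with hVdef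
  set a : ℕ → ℝ := fun n => (n : ℝ) ^ ((1 : ℝ) / 3) * α n with ha
  set q : ℕ → ℝ := fun n => 2 * C / (α n * √(V n)) with hq
  have ha3 : ∀ n, a n ^ 3 = n * α n ^ 3 := fun n => by
    simp only [ha]
    rw [mul_pow, ← Real.rpow_natCast, ← Real.rpow_mul (Nat.cast_nonneg n)]
    norm_num
  -- With `n ≥ 2` there is at least one transition, so the minimum is over a nonempty set and is at
  -- most one.
  have good : ∀ᶠ n in atTop, 2 ≤ n ∧ 0 < α n := by
    filter_upwards [eventually_ge_atTop 2, hα.eventually_gt_atTop 0] with n h2 h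
    exact ⟨h2, pos_of_mul_pos_right h (by positivity)⟩
  have bounds : ∀ n, 2 ≤ n → 0 < α n → _ := fun n h2 hpos =>
    (hX n (by omega)).variance_and_charFun_bounds (by omega) (hπ n) (hf n) (hC n) (hvar n) hpos
      ((DobrushinCLT.minAlpha_le (π := π n) le_rfl h2).trans (DobrushinCLT.alphaCoeff_le_one _))
      (fun i h1 h2 => DobrushinCLT.minAlpha_le h1 h2) (V := V n) rfl
  have Vpos : ∀ n, 2 ≤ n → 0 < α n → 0 < V n := fun n h2 hpos => by
    have h := (bounds n h2 hpos).1
    have hn : (0 : ℝ) < n := by exact_mod_cast (by omega : 0 < n)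
    have : 0 < α n * (n * c) := by positivity
    linarith
  have q_lim : Tendsto q atTop (𝓝 0) := by
    have h3 : Tendsto (fun n => 48 * C ^ 2 / c * (a n ^ 3)⁻¹) atTop (𝓝 0) := by
      have := (tendsto_inv_atTop_zero.comp
        ((tendsto_pow_atTop (n := 3) (by norm_num)).comp hα)).const_mul (48 * C ^ 2 / c)
      simpa using this
    have hsq : Tendsto (fun n => q n ^ 2) atTop (𝓝 0) := by
      refine tendsto_of_tendsto_of_tendsto_of_le_of_le' tendsto_const_nhds h3
        (Eventually.of_forall fun n => sq_nonneg _) ?_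
      filter_upwards [good] with n ⟨h2, hpos⟩
      have hV := Vpos n h2 hpos
      have hn : (0 : ℝ) < n := by exact_mod_cast (by omega : 0 < n)
      have hb := (bounds n h2 hpos).1
      have e : q n ^ 2 = 4 * C ^ 2 / (α n ^ 2 * V n) := by
        simp only [hq]
        rw [div_pow, mul_pow (α n), Real.sq_sqrt hV.le]; ring
      -- Inserting `V ≥ α n c / 12` turns `4 C ^ 2 / (α ^ 2 V)` into `48 C ^ 2 / (c n α ^ 3)`, and
      -- `n α ^ 3` is the cube of `n ^ (1/3) α`.
      rw [e, ha3, ← div_eq_mul_inv, div_div, div_le_div_iff₀ (by positivity) (by positivity)]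
      have := mul_le_mul_of_nonneg_left hb (by positivity : 0 ≤ 4 * C ^ 2 * α n ^ 2)
      linarith
    have := hsq.sqrt
    simp only [Real.sqrt_sq_eq_abs, Real.sqrt_zero] at this
    exact tendsto_zero_iff_abs_tendsto_zero q |>.2 this
  refine ⟨fun n => (mZ n).aemeasurable, by fun_prop, ?_⟩
  refine ProbabilityMeasure.tendsto_iff_tendsto_charFun.2 fun t => ?_
  have hlim : charFun ((gaussianReal 0 1).map (id : ℝ → ℝ)) t =
      ((Real.exp (-(t ^ 2 / 2)) : ℝ) : ℂ) := by
    rw [Measure.map_id, charFun_gaussianReal]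
    push_cast
    congr 1
    ring
  show Tendsto (fun n => charFun ((P n).map _) t) atTop
    (𝓝 (charFun ((gaussianReal 0 1).map (id : ℝ → ℝ)) t))
  rw [hlim, tendsto_iff_norm_sub_tendsto_zero]
  have small : Tendsto (fun n => (2 * (t ^ 2 + 1) + 1 + Real.exp (t ^ 2 + 2)) *
      ((2 * |t| + 6 * t ^ 2) * q n)) atTop (𝓝 0) := by
    simpa using (q_lim.const_mul (2 * |t| + 6 * t ^ 2)).const_mul
      (2 * (t ^ 2 + 1) + 1 + Real.exp (t ^ 2 + 2))
  have ht : ∀ᶠ n in atTop, |t| * (2 * q n) ≤ 1 := by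
    have : Tendsto (fun n => |t| * (2 * q n)) atTop (𝓝 0) := by
      simpa using (q_lim.const_mul 2).const_mul |t|
    exact this.eventually_le_const one_pos
  refine tendsto_of_tendsto_of_tendsto_of_le_of_le' tendsto_const_nhds small
    (Eventually.of_forall fun n => norm_nonneg _) ?_
  filter_upwards [good, ht] with n ⟨h2, hpos⟩ htn
  have key := (bounds n h2 hpos).2 t (Vpos n h2 hpos) htn
  rw [charFun_apply_real, integral_map (mZ n).aemeasurable
    (Measurable.aestronglyMeasurable (by fun_prop))]
  refine le_of_eq_of_le ?_ key
  congr 2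
  refine integral_congr_ae (ae_of_all _ fun ω => ?_)
  simp only [hVdef]
  push_cast
  congr 2
  ring
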